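/- Let $t_0\in\mathbb R$, $x_0\in\mathbb R^n$, let $V\subset\mathbb R^m$ be compact, let $E,I$ be finite index sets, let $\Phi^0,\Phi^k:\mathbb R^n\to\mathbb R$ ($k\in E\cup I$) be continuously differentiable, and let $f(x,u,t)\in\mathbb R^n$ be defined for $x\in\mathbb R^n$, $u\in V$, $t\ge t_0$, differentiable in $x$, with $f$ and $f_x=\partial f/\partial x$ continuous in all arguments, and Lipschitz in $x$ uniformly in $u\in V$ and $t\in[t_0,T]$ for each $T$. Consider the problem with free terminal time $T>t_0$ $$\Phi^0(x(T))\to\min,\qquad \dot x=f(x,u,t)\ \text{on }[t_0,T],\quad x(t_0)=x_0,\quad u(t)\in V,$$ $$\Phi^k(x(T))=0\ (k\in E),\qquad \Phi^k(x(T))\le 0\ (k\in I),$$ with $u$ and $\dot x$ piecewise continuous on $[t_0,T]$ (finitely many jumps, right-continuous on $[t_0,T)$, left-continuous at $T$; derivatives at jumps are right-hand ones). Let $X$ be the set of all triples $(x,u,T)$ with $T>t_0$, $x(t)=x_0+\int_{t_0}^t\dot x$, $\dot x$ and $u$ piecewise continuous on $[t_0,T]$ and $u(t)\in V$; the differential equation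 is not required in $X$. Let $X$ carry the distance given by the sum of the $L^2$ distances of $\dot x$ and of $u$ (extended by $0$ outside $[t_0,T]$) and of $|T-T'|$, let $\Omega\subset X$ be the set of triples satisfying all constraints, and put $J(x,u,T)=\Phi^0(x(T))$, $$F_\lambda(x,u,T)=\Phi^0(x(T))+\lambda\,\|\dot x-f(x,u,\cdot)\|_{L^2[t_0,T]}+\lambda\max_{k\in E,\,j\in I}\{0,|\Phi^k(x(T))|,\Phi^j(x(T))\}.$$ Let $(x^*,u^*,T^*)\in\Omega$, let $N\subset X$ be a neighbourhood of it ($N=X$ is allowed), suppose that $(x^*,u^*,T^*)$ minimises $J$ over $N\cap\Omega$, and suppose that the penalty function is exact on $N$, that is, $\inf_N F_\lambda=\inf_{N\cap\Omega}J$ for some $\lambda\ge0$. (The Unified Separation Condition, which serves to secure exactness, is not needed in addition.) Then there are a continuous function $\psi:[t_0,T^*]\to\mathbb R^n$ and multipliers $\nu_k\in\mathbb R$ ($k\in E$) and $\mu_k\ge0$ ($k\in I$), with $\mu_k\Phi^k(x^*(T^*))=0$, such that, with $H(x,u,\psi,t)=\langle\psi,f(x,u,t)\rangle$: 1. $\dot\psi(t)=-f_x(x^*(t),u^*(t),t)^{T}\psi(t)$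 on $[t_0,T^*)$; 2. $H(x^*(t),u^*(t),\psi(t),t)=\max_{v\in V}H(x^*(t),v,\psi(t),t)$ for all $t\in[t_0,T^*]$; in particular $f_u(x^*(t),u^*(t),t)^{T}\psi(t)=0$ whenever $u^*(t)$ is an interior point of $V$ and $f(x^*(t),\cdot,t)$ is differentiable at $u^*(t)$; 3. $\psi(T^*)=-\nabla\Phi^0(x^*(T^*))-\sum_{k\in E}\nu_k\nabla\Phi^k(x^*(T^*))-\sum_{k\in I}\mu_k\nabla\Phi^k(x^*(T^*))$; 4. $H(x^*(T^*),u^*(T^*),\psi(T^*),T^*)=0$. -/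

import Mathlib

open Set Filter Topology MeasureTheory

noncomputable section

/-- `g` is piecewise continuous on `[a, b]`: it is continuous off a finite set, has one-sided limits
at every point, and is normalised in the usual way: its value at a jump is the right-hand limit, and
its value at the right end `b` is the left-hand limit. Only the values of `g` on `[a, b]` matter. -/
def PiecewiseContinuousOn {F : Type*} [TopologicalSpace F] (g : ℝ → F) (a b : ℝ) : Prop :=
  (∃ s : Finset ℝ, ∀ t ∈ Icc a b, t ∉ s → ContinuousWithinAt g (Icc a b) t) ∧
  (∀ t ∈ Ico a b, ContinuousWithinAt g (Icc t b) t) ∧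
  (∀ t ∈ Ioc a b, ∃ l, Tendsto g (𝓝[<] t) (𝓝 l)) ∧
  ContinuousWithinAt g (Icc a b) b

/-- Data of a free-terminal-time Mayer problem with time-independent terminal data:
minimise `Φ₀ (x T)` over `(x, u, T)` subject to `x' = f (x, u, t)` on `[t₀, T]`, `x t₀ = x₀`,
`u t ∈ V`, `ΦE k (x T) = 0` for all `k` and `ΦI j (x T) ≤ 0` for all `j`. -/
structure MayerProblem (n m : ℕ) (E I : Type*) where
  t₀ : ℝ
  x₀ : EuclideanSpace ℝ (Fin n)
  V : Set (EuclideanSpace ℝ (Fin m))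
  f : EuclideanSpace ℝ (Fin n) → EuclideanSpace ℝ (Fin m) → ℝ → EuclideanSpace ℝ (Fin n)
  Φ₀ : EuclideanSpace ℝ (Fin n) → ℝ
  ΦE : E → EuclideanSpace ℝ (Fin n) → ℝ
  ΦI : I → EuclideanSpace ℝ (Fin n) → ℝ

/-- A triple `(z, u, T)`: velocity `z = x'`, control `u`, terminal time `T`. -/
structure Triple (n m : ℕ) where
  z : ℝ → EuclideanSpace ℝ (Fin n)
  u : ℝ → EuclideanSpace ℝ (Fin m)
  T : ℝ

namespace MayerProblem

variable {n m : ℕ} {E I : Type*} (P : MayerProblem n m E I)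

/-- The partial derivative `∂f/∂x`. -/
def fx (x : EuclideanSpace ℝ (Fin n)) (u : EuclideanSpace ℝ (Fin m)) (t : ℝ) :
    EuclideanSpace ℝ (Fin n) →L[ℝ] EuclideanSpace ℝ (Fin n) :=
  fderiv ℝ (fun y => P.f y u t) x

/-- The partial derivative `∂f/∂u`. -/
def fu (x : EuclideanSpace ℝ (Fin n)) (u : EuclideanSpace ℝ (Fin m)) (t : ℝ) :
    EuclideanSpace ℝ (Fin m) →L[ℝ] EuclideanSpace ℝ (Fin n) :=
  fderiv ℝ (fun v => P.f x v t) u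

/-- The standing assumptions: `V` is compact, `f` is differentiable in `x`, `f` and `∂f/∂x` are
continuous in all arguments, `f` is Lipschitz in `x` uniformly in `u ∈ V` and in `t ∈ [t₀, T]` for
each `T`, and the terminal functions are continuously differentiable. -/
structure Standing : Prop where
  compact_V : IsCompact P.V
  differentiable_f : ∀ x, ∀ u ∈ P.V, ∀ t, P.t₀ ≤ t → DifferentiableAt ℝ (fun y => P.f y u t) x
  continuous_f :
    ContinuousOn
      (fun p : EuclideanSpace ℝ (Fin n) × EuclideanSpace ℝ (Fin m) × ℝ => P.f p.1 p.2.1 p.2.2)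
      (univ ×ˢ P.V ×ˢ Ici P.t₀)
  continuous_fx :
    ContinuousOn
      (fun p : EuclideanSpace ℝ (Fin n) × EuclideanSpace ℝ (Fin m) × ℝ => P.fx p.1 p.2.1 p.2.2)
      (univ ×ˢ P.V ×ˢ Ici P.t₀)
  lipschitz_f : ∀ T, ∃ L : NNReal, ∀ u ∈ P.V, ∀ t ∈ Icc P.t₀ T,
    LipschitzWith L (fun x => P.f x u t)
  smooth_cost : ContDiff ℝ 1 P.Φ₀
  smooth_eq : ∀ k, ContDiff ℝ 1 (P.ΦE k)
  smooth_ineq : ∀ j, ContDiff ℝ 1 (P.ΦI j)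

/-- The state `x t = x₀ + ∫_{t₀}^t z` of a triple. -/
def state (ξ : Triple n m) (t : ℝ) : EuclideanSpace ℝ (Fin n) :=
  P.x₀ + ∫ τ in P.t₀..t, ξ.z τ

/-- The underlying space of the penalised problem: all triples with `T > t₀`, `z` and `u` piecewise
continuous on `[t₀, T]`, and `u` with values in `V`. State and control are independent here. -/
def space : Set (Triple n m) :=
  {ξ | P.t₀ < ξ.T ∧ PiecewiseContinuousOn ξ.z P.t₀ ξ.T ∧ PiecewiseContinuousOn ξ.u P.t₀ ξ.T ∧
    ∀ t ∈ Icc P.t₀ ξ.T, ξ.u t ∈ P.V}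

/-- The admissible set: triples obeying the differential equation and the terminal constraints. -/
def admissible : Set (Triple n m) :=
  {ξ | ξ ∈ P.space ∧
    (∀ t ∈ Icc P.t₀ ξ.T, ξ.z t = P.f (P.state ξ t) (ξ.u t) t) ∧
    (∀ k, P.ΦE k (P.state ξ ξ.T) = 0) ∧ ∀ j, P.ΦI j (P.state ξ ξ.T) ≤ 0}

/-- The cost `J = Φ₀ (x T)`. -/
def cost (ξ : Triple n m) : ℝ := P.Φ₀ (P.state ξ ξ.T)

/-- The `L²[t₀, T]`-penalty `‖x' - f (x, u, t)‖` for the differential equation. -/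
def penaltyDiff (ξ : Triple n m) : ℝ :=
  √(∫ t in P.t₀..ξ.T, ‖ξ.z t - P.f (P.state ξ t) (ξ.u t) t‖ ^ 2)

/-- The terminal penalty `max {0, |ΦE k (x T)|, ΦI j (x T)}` over all `k` and `j`. -/
def penaltyTerm (ξ : Triple n m) : ℝ :=
  max (⨆ k, |P.ΦE k (P.state ξ ξ.T)|) (⨆ j, max 0 (P.ΦI j (P.state ξ ξ.T)))

/-- The penalty function `F_c = J + c (φ_diff + φ_term)`. -/
def penalized (c : ℝ) (ξ : Triple n m) : ℝ :=
  P.cost ξ + c * (P.penaltyDiff ξ + P.penaltyTerm ξ)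

/-- The distance between triples: the `L²` distances of velocities and of controls (extended by zero
off `[t₀, T]`) plus the distance of the terminal times. -/
def rho (ξ η : Triple n m) : ℝ :=
  √(∫ t, ‖(Icc P.t₀ ξ.T).indicator ξ.z t - (Icc P.t₀ η.T).indicator η.z t‖ ^ 2) +
  √(∫ t, ‖(Icc P.t₀ ξ.T).indicator ξ.u t - (Icc P.t₀ η.T).indicator η.u t‖ ^ 2) +
  |ξ.T - η.T|

/-- `N` is a neighbourhood of `ξ` in the space of triples with the distance `rho`. -/
def IsNhd (N : Set (Triple n m)) (ξ : Triple n m) : Prop :=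
  N ⊆ P.space ∧ ∃ r > 0, ∀ η ∈ P.space, P.rho η ξ < r → η ∈ N

/-- `ξ` is optimal in `N`: it is admissible, and no admissible triple in `N` has smaller cost. -/
def IsOptimalIn (N : Set (Triple n m)) (ξ : Triple n m) : Prop :=
  ξ ∈ P.admissible ∧ ∀ η ∈ N ∩ P.admissible, P.cost ξ ≤ P.cost η

/-- `c ≥ 0` is an exact penalty constant on `N`: the infimum of the penalty function over `N` equals
the infimum of the cost over the admissible triples in `N`. -/
def IsExactPenaltyConstant (N : Set (Triple n m)) (c : ℝ) : Prop :=
  0 ≤ c ∧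
    (⨅ ξ ∈ N, ((P.penalized c ξ : ℝ) : EReal)) = ⨅ ξ ∈ N ∩ P.admissible, ((P.cost ξ : ℝ) : EReal)

/-- The Hamiltonian `H (x, u, ψ, t) = ⟨ψ, f (x, u, t)⟩`. -/
def hamiltonian (x : EuclideanSpace ℝ (Fin n)) (u : EuclideanSpace ℝ (Fin m))
    (ψ : EuclideanSpace ℝ (Fin n)) (t : ℝ) : ℝ :=
  inner ℝ ψ (P.f x u t)

/-- `ψ` solves the adjoint equation `ψ' = -(∂f/∂x)ᵀ ψ` along `ξ` on `[t₀, T]`; at the jumps of the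
control the derivative is the right-hand one. -/
def IsAdjoint (ξ : Triple n m) (ψ : ℝ → EuclideanSpace ℝ (Fin n)) : Prop :=
  ContinuousOn ψ (Icc P.t₀ ξ.T) ∧
  ∀ t ∈ Ico P.t₀ ξ.T,
    HasDerivWithinAt ψ
      (-(ContinuousLinearMap.adjoint (P.fx (P.state ξ t) (ξ.u t) t)) (ψ t)) (Ici t) t

end MayerProblem

end

/-! Exactness turns the optimal triple into a minimiser of the penalty function over `N`, so it may
be compared with triples that violate the terminal constraints. The comparison triples are genuine
trajectories: the control is changed on finitely many needles of length `ε * α i` and the terminal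
time is shifted by `ε * β`. Their differential penalty vanishes, and they tend to `ξ` in `rho`, so
they eventually lie in `N`.

To first order the end point moves by `d = ∑ α i • M (τ i) (f(v i) - f(u)) + β • f(T)`, where `M' =
-M A`, `M T = 1` and `A` is `∂f/∂x` along `ξ` (`tendsto_first_variation`,
`exists_needle_variation`). Minimality then gives `0 ≤ ⟨∇Φ₀, d⟩ + c * s` for every `s ≥ 0` that
dominates all `|⟨∇ΦE k, d⟩|` and all active `⟨∇ΦI j, d⟩` (`nonneg_on_variation`).

These directions form a convex cone. A separation argument (`exists_multipliers_of_forall_mem_cone`)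
replaces the maximum, whose maximiser depends on `d`, by one fixed vector `p = ∇Φ₀ + ∑ ν ∇ΦE + ∑ μ
∇ΦI` that is nonnegative on the whole cone. With `ψ = -Mᵀ p`, single needles give the maximum
principle and the two directions `±f(T)` give the vanishing Hamiltonian. The cost multiplier is 1
because the penalty constant is finite; no constraint qualification enters. -/

noncomputable section

/-! ### Multipliers by separation from a dual cone -/

/-- A minimax statement: the compact convex set of all `a₀ + c ∑ w i • b i`, `w` in the simplex,
must meet the dual cone of `K`. Otherwise a separating functional would be a direction in the
closure of `K` violating the hypothesis. -/
theorem exists_multipliers_of_forall_mem_cone {X ι : Type*} [NormedAddCommGroup X]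
    [InnerProductSpace ℝ X] [CompleteSpace X] [Fintype ι] (K : PointedCone ℝ X) (a₀ : X)
    (a : ι → X) {c : ℝ} (hc : 0 ≤ c)
    (h : ∀ d ∈ K, ∀ s, 0 ≤ s → (∀ i, inner ℝ (a i) d ≤ s) → 0 ≤ inner ℝ a₀ d + c * s) :
    ∃ l : ι → ℝ, (∀ i, 0 ≤ l i) ∧ ∀ d ∈ K, 0 ≤ inner ℝ (a₀ + ∑ i, l i • a i) d := by
  classical
  -- The extra vector `0` makes the maximum of `inner ℝ (b o) d` nonnegative, as the hypothesis
  -- requires of `s`.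
  let b : Option ι → X := fun o => o.elim 0 a
  let g : (Option ι → ℝ) → X := fun w => a₀ + c • ∑ i, w i • b i
  have hg : Continuous g := by fun_prop
  by_cases hd : Disjoint (g '' stdSimplex ℝ (Option ι)) (ProperCone.innerDual (K : Set X) : Set X)
  · exfalso
    have hconv : Convex ℝ (g '' stdSimplex ℝ (Option ι)) := by
      rintro _ ⟨x, hx, rfl⟩ _ ⟨y, hy, rfl⟩ p q hp hq hpq
      refine ⟨p • x + q • y, convex_stdSimplex ℝ _ hx hy hp hq hpq, ?_⟩
      have : a₀ = p • a₀ + q • a₀ := by rw [← add_smul, hpq, one_smul]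
      simp only [g, Pi.add_apply, Pi.smul_apply, smul_eq_mul, add_smul, Finset.sum_add_distrib,
        mul_smul, ← Finset.smul_sum, smul_add]
      conv_lhs => rw [this]
      rw [smul_comm c p, smul_comm c q]
      abel
    obtain ⟨f, hf, hf'⟩ := ProperCone.hyperplane_separation (ProperCone.innerDual (K : Set X)) hconv
      ((isCompact_stdSimplex ℝ (Option ι)).image hg) hd
    set d := (InnerProductSpace.toDual ℝ X).symm f with hd_def
    have hfd : ∀ y, f y = inner ℝ y d := fun y => by
      rw [real_inner_comm, hd_def, InnerProductSpace.toDual_symm_apply]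
    -- Bipolar theorem: `d` is nonnegative on the dual cone of `K`.
    have hdK : d ∈ closure (K : Set X) := by
      by_contra hn
      have hn' : d ∉ (Submodule.closure K : ProperCone ℝ X) := by
        intro hh
        exact hn hh
      obtain ⟨y, hy, hy'⟩ := ProperCone.hyperplane_separation' _ hn'
      have := hf y (by
        rw [ProperCone.mem_innerDual]
        intro x hx
        exact hy x (subset_closure hx))
      rw [hfd, real_inner_comm] at this
      linarith
    obtain ⟨o, ho⟩ := Finite.exists_max (fun o => inner ℝ (b o) d)
    have hs0 : 0 ≤ inner ℝ (b o) d := by simpa [b] using ho none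
    -- `K` need not be closed; the slack `η` keeps the constraints valid at points of `K` near `d`.
    have key : ∀ η > 0, 0 ≤ inner ℝ a₀ d + c * (inner ℝ (b o) d + η) := by
      intro η hη
      have h1 : ∀ᶠ d' in 𝓝[(K : Set X)] d, ∀ i, inner ℝ (a i) d' ≤ inner ℝ (b o) d + η := by
        rw [eventually_all]
        intro i
        have : Tendsto (fun d' => inner ℝ (a i) d') (𝓝[(K : Set X)] d) (𝓝 (inner ℝ (a i) d)) :=
          (Continuous.tendsto (by fun_prop) d).mono_left nhdsWithin_le_nhds
        refine (this.eventually_lt_const ?_).mono fun _ => le_of_lt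
        have : inner ℝ (a i) d ≤ inner ℝ (b o) d := ho (some i)
        exact lt_of_le_of_lt this (by linarith)
      have h2 : ∀ᶠ d' in 𝓝[(K : Set X)] d, 0 ≤ inner ℝ a₀ d' + c * (inner ℝ (b o) d + η) := by
        filter_upwards [h1, self_mem_nhdsWithin] with d' hd' hK
        exact h d' hK _ (by linarith) hd'
      have h3 : Tendsto (fun d' => inner ℝ a₀ d' + c * (inner ℝ (b o) d + η)) (𝓝[(K : Set X)] d)
          (𝓝 (inner ℝ a₀ d + c * (inner ℝ (b o) d + η))) :=
        (Continuous.tendsto (by fun_prop) d).mono_left nhdsWithin_le_nhds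
      have : (𝓝[(K : Set X)] d).NeBot := mem_closure_iff_nhdsWithin_neBot.1 hdK
      exact ge_of_tendsto h3 h2
    have key' : 0 ≤ inner ℝ a₀ d + c * inner ℝ (b o) d := by
      have : Tendsto (fun η : ℝ => inner ℝ a₀ d + c * (inner ℝ (b o) d + η)) (𝓝[>] 0)
          (𝓝 (inner ℝ a₀ d + c * (inner ℝ (b o) d + 0))) :=
        (Continuous.tendsto (by fun_prop) 0).mono_left nhdsWithin_le_nhds
      simpa using ge_of_tendsto this (eventually_nhdsWithin_of_forall key)
    -- The vertex of the simplex at the maximising index gives the contradiction.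
    have := hf' _ ⟨Pi.single o 1, single_mem_stdSimplex ℝ o, rfl⟩
    rw [hfd] at this
    simp only [g, Pi.single_apply, ite_smul, one_smul, zero_smul, Finset.sum_ite_eq',
      Finset.mem_univ, if_true, inner_add_left, real_inner_smul_left] at this
    linarith
  · rw [Set.not_disjoint_iff] at hd
    obtain ⟨_, ⟨w, hw, rfl⟩, hp⟩ := hd
    refine ⟨fun i => c * w (some i), fun i => mul_nonneg hc (hw.1 _), fun d hd => ?_⟩
    have := ProperCone.mem_innerDual.1 hp hd
    rw [real_inner_comm] at this
    simpa [g, b, Fintype.sum_option, Finset.smul_sum, mul_smul] using this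

/-! ### Global solutions of integral equations -/

/-- Integral form of the Picard–Lindelöf theorem for a field that is Lipschitz in the state and
merely integrable in time. -/
theorem exists_integral_solution {F : Type*} [NormedAddCommGroup F] [NormedSpace ℝ F]
    [CompleteSpace F] {g : ℝ → F → F} {a b : ℝ} (hab : a ≤ b) {K : NNReal}
    (hlip : ∀ t ∈ Icc a b, LipschitzWith K (g t))
    (hint : ∀ x : ℝ → F, Continuous x → IntervalIntegrable (fun t => g t (x t)) volume a b)
    (x₀ : F) :
    ∃ x : ℝ → F, Continuous x ∧ ∀ t ∈ Icc a b, x t = x₀ + ∫ s in a..t, g s (x s) := by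
  set k : ℝ := K + 1 with hk
  have hk0 : 0 < k := by positivity
  let pr : ℝ → Icc a b := projIcc a b hab
  -- Fixed points are sought for `w = exp (-2kt) x`, so that the sup distance becomes an
  -- exponentially weighted one. The Picard map then contracts by `1/2` on the whole interval,
  -- without a smallness condition on `b - a`.
  let lift : C(Icc a b, F) → ℝ → F := fun w s => Real.exp (2 * k * s) • w (pr s)
  have hlift : ∀ w, Continuous (lift w) := fun w => by
    have : Continuous pr := continuous_projIcc
    fun_prop
  have hii : ∀ w, ∀ t ∈ Icc a b, IntervalIntegrable (fun s => g s (lift w s)) volume a t :=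
    fun w t ht => (hint _ (hlift w)).mono_set (by
      rw [uIcc_of_le hab, uIcc_of_le ht.1]; exact Icc_subset_Icc le_rfl ht.2)
  have hcont : ∀ w, ContinuousOn (fun t => ∫ s in a..t, g s (lift w s)) (Icc a b) := fun w => by
    have := intervalIntegral.continuousOn_primitive_interval
      (f := fun s => g s (lift w s)) (μ := volume) (a := a) (b := b)
      ((intervalIntegrable_iff' (by simp)).1 (hint _ (hlift w)))
    rwa [uIcc_of_le hab] at this
  let S : C(Icc a b, F) → C(Icc a b, F) := fun w =>
    ⟨fun t => Real.exp (-(2 * k * t)) • (x₀ + ∫ s in a..t, g s (lift w s)), by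
      have := (hcont w).domRestrict
      have h2 : Continuous fun t : Icc a b => ∫ s in a..(t : ℝ), g s (lift w s) := this
      fun_prop⟩
  have hS : ContractingWith (1 / 2) S := by
    refine ⟨by norm_num, LipschitzWith.of_dist_le_mul fun w₁ w₂ => ?_⟩
    refine (ContinuousMap.dist_le (by positivity)).2 fun t => ?_
    obtain ⟨t, ht⟩ := t
    simp only [S, ContinuousMap.coe_mk]
    rw [dist_eq_norm, ← smul_sub, add_sub_add_left_eq_sub,
      ← intervalIntegral.integral_sub (hii _ t ht) (hii _ t ht), norm_smul, Real.norm_eq_abs,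
      abs_of_pos (Real.exp_pos _)]
    have hb : ‖∫ s in a..t, (g s (lift w₁ s) - g s (lift w₂ s))‖ ≤
        ∫ s in a..t, k * dist w₁ w₂ * Real.exp (2 * k * s) := by
      refine intervalIntegral.norm_integral_le_of_norm_le ht.1 ?_
        (Continuous.intervalIntegrable (by fun_prop) _ _)
      refine Eventually.of_forall fun s hs => ?_
      have hs' : s ∈ Icc a b := ⟨hs.1.le, hs.2.trans ht.2⟩
      rw [← dist_eq_norm]
      refine ((hlip s hs').dist_le_mul _ _).trans ?_
      simp only [lift, dist_smul₀, Real.norm_eq_abs, abs_of_pos (Real.exp_pos _)]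
      have h1 := ContinuousMap.dist_apply_le_dist (f := w₁) (g := w₂) (pr s)
      have h2 := Real.exp_pos (2 * k * s)
      have h3 : (K : ℝ) ≤ k := by simp [hk]
      calc (K : ℝ) * (Real.exp (2 * k * s) * dist (w₁ (pr s)) (w₂ (pr s)))
          ≤ k * (Real.exp (2 * k * s) * dist w₁ w₂) := by gcongr
        _ = _ := by ring
    have hI : ∫ s in a..t, k * dist w₁ w₂ * Real.exp (2 * k * s) =
        dist w₁ w₂ / 2 * (Real.exp (2 * k * t) - Real.exp (2 * k * a)) := by
      rw [intervalIntegral.integral_const_mul, intervalIntegral.integral_comp_mul_left _ (by positivity),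
        integral_exp, smul_eq_mul]
      field_simp
    calc _ ≤ Real.exp (-(2 * k * t)) *
          (dist w₁ w₂ / 2 * (Real.exp (2 * k * t) - Real.exp (2 * k * a))) := by
          rw [← hI]; gcongr
      _ ≤ Real.exp (-(2 * k * t)) * (dist w₁ w₂ / 2 * (Real.exp (2 * k * t))) := by
          gcongr
          linarith [Real.exp_pos (2 * k * a)]
      _ = dist w₁ w₂ / 2 * (Real.exp (-(2 * k * t)) * Real.exp (2 * k * t)) := by ring
      _ = _ := by rw [← Real.exp_add]; norm_num; ring
  obtain ⟨w, hw, -⟩ := hS.exists_fixedPoint 0 (edist_ne_top _ _)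
  refine ⟨lift w, hlift w, fun t ht => ?_⟩
  have h1 : w ⟨t, ht⟩ = Real.exp (-(2 * k * t)) • (x₀ + ∫ s in a..t, g s (lift w s)) :=
    (congrArg (fun v : C(Icc a b, F) => v ⟨t, ht⟩) hw).symm
  have h2 : pr t = ⟨t, ht⟩ := projIcc_of_mem hab ht
  change Real.exp (2 * k * t) • w (pr t) = _
  rw [h2, h1, smul_smul, ← Real.exp_add]
  simp

/-! ### Calculus of piecewise continuous functions -/

theorem nhdsLT_le_nhdsWithin_Icc {a b t : ℝ} (ht : t ∈ Ioc a b) : 𝓝[<] t ≤ 𝓝[Icc a b] t :=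
  nhdsWithin_le_iff.2 (mem_of_superset (Ico_mem_nhdsLT ht.1)
    fun _ hs => ⟨hs.1, hs.2.le.trans ht.2⟩)

theorem nhdsWithin_Icc_le_sup (a b t : ℝ) : 𝓝[Icc a b] t ≤ 𝓝[<] t ⊔ 𝓝[Icc t b] t := by
  rw [← nhdsWithin_union]
  exact nhdsWithin_mono _ fun s hs => (lt_or_ge s t).imp id fun h => ⟨h, hs.2⟩

theorem ContinuousOn.piecewiseContinuousOn {F : Type*} [TopologicalSpace F] {g : ℝ → F} {a b : ℝ}
    (hab : a ≤ b) (hg : ContinuousOn g (Icc a b)) : PiecewiseContinuousOn g a b :=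
  ⟨⟨∅, fun t ht _ => hg t ht⟩,
    fun t ht => (hg t ⟨ht.1, ht.2.le⟩).mono (Icc_subset_Icc ht.1 le_rfl),
    fun t ht => ⟨g t, (hg t ⟨ht.1.le, ht.2⟩).mono_left (nhdsLT_le_nhdsWithin_Icc ht)⟩,
    hg b ⟨hab, le_rfl⟩⟩

namespace PiecewiseContinuousOn

section Topology

variable {F G : Type*} [TopologicalSpace F] [TopologicalSpace G] {g g' : ℝ → F} {h : ℝ → G}
  {a b : ℝ}

theorem congr (hab : a ≤ b) (hg : PiecewiseContinuousOn g a b) (hgg : EqOn g' g (Icc a b)) :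
    PiecewiseContinuousOn g' a b := by
  obtain ⟨⟨s, hs⟩, h2, h3, h4⟩ := hg
  refine ⟨⟨s, fun t ht hts => (hs t ht hts).congr hgg (hgg ht)⟩,
    fun t ht => (h2 t ht).congr (hgg.mono (Icc_subset_Icc ht.1 le_rfl)) (hgg ⟨ht.1, ht.2.le⟩),
    fun t ht => ?_, h4.congr hgg (hgg ⟨hab, le_rfl⟩)⟩
  obtain ⟨l, hl⟩ := h3 t ht
  refine ⟨l, hl.congr' ?_⟩
  filter_upwards [Ico_mem_nhdsLT ht.1] with s hs
  exact (hgg ⟨hs.1, hs.2.le.trans ht.2⟩).symm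

theorem prodMk (hg : PiecewiseContinuousOn g a b) (hh : PiecewiseContinuousOn h a b) :
    PiecewiseContinuousOn (fun t => (g t, h t)) a b := by
  classical
  obtain ⟨⟨s, hs⟩, h2, h3, h4⟩ := hg
  obtain ⟨⟨s', hs'⟩, h2', h3', h4'⟩ := hh
  refine ⟨⟨s ∪ s', fun t ht hts => ?_⟩, fun t ht => (h2 t ht).prodMk (h2' t ht), fun t ht => ?_,
    h4.prodMk h4'⟩
  · rw [Finset.mem_union, not_or] at hts
    exact (hs t ht hts.1).prodMk (hs' t ht hts.2)
  · obtain ⟨l, hl⟩ := h3 t ht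
    obtain ⟨l', hl'⟩ := h3' t ht
    exact ⟨(l, l'), hl.prodMk_nhds hl'⟩

/-- Closedness of `S` serves the left limits: they are not values of `g`, yet `φ` must be continuous
there. -/
theorem comp_continuousOn (hab : a ≤ b) (hg : PiecewiseContinuousOn g a b) {S : Set F}
    (hS : IsClosed S) (hgS : ∀ t ∈ Icc a b, g t ∈ S) {φ : F → G} (hφ : ContinuousOn φ S) :
    PiecewiseContinuousOn (fun t => φ (g t)) a b := by
  obtain ⟨⟨s, hs⟩, h2, h3, h4⟩ := hg
  refine ⟨⟨s, fun t ht hts => (hφ _ (hgS t ht)).comp (hs t ht hts) hgS⟩,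
    fun t ht => (hφ _ (hgS t ⟨ht.1, ht.2.le⟩)).comp (h2 t ht)
      fun s hs => hgS s ⟨ht.1.trans hs.1, hs.2⟩,
    fun t ht => ?_, (hφ _ (hgS b ⟨hab, le_rfl⟩)).comp h4 hgS⟩
  obtain ⟨l, hl⟩ := h3 t ht
  have hev : ∀ᶠ s in 𝓝[<] t, g s ∈ S := by
    filter_upwards [Ico_mem_nhdsLT ht.1] with s hs
    exact hgS s ⟨hs.1, hs.2.le.trans ht.2⟩
  exact ⟨φ l, (hφ l (hS.mem_of_tendsto hl hev)).tendsto.comp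
    (tendsto_nhdsWithin_iff.2 ⟨hl, hev⟩)⟩

theorem comp_continuous (hab : a ≤ b) (hg : PiecewiseContinuousOn g a b) {φ : F → G}
    (hφ : Continuous φ) : PiecewiseContinuousOn (fun t => φ (g t)) a b :=
  hg.comp_continuousOn hab isClosed_univ (fun _ _ => mem_univ _) hφ.continuousOn

/-- Truncation at a jump would break the left-continuous normalisation at the new right end, hence
the condition at `b'`. -/
theorem restrict_right (hg : PiecewiseContinuousOn g a b) {b' : ℝ} (hb : b' ≤ b)
    (hb' : ContinuousWithinAt g (Icc a b') b') : PiecewiseContinuousOn g a b' := by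
  obtain ⟨⟨s, hs⟩, h2, h3, -⟩ := hg
  exact ⟨⟨s, fun t ht hts => (hs t ⟨ht.1, ht.2.trans hb⟩ hts).mono (Icc_subset_Icc le_rfl hb)⟩,
    fun t ht => (h2 t ⟨ht.1, ht.2.trans_le hb⟩).mono (Icc_subset_Icc le_rfl hb),
    fun t ht => h3 t ⟨ht.1, ht.2.trans hb⟩, hb'⟩

/-- Extension beyond the right end by the value there. -/
theorem comp_min {B : ℝ} (hab : a ≤ b) (hbB : b ≤ B) (hg : PiecewiseContinuousOn g a b) :
    PiecewiseContinuousOn (fun t => g (min t b)) a B := by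
  have hmaps : MapsTo (fun t => min t b) (Icc a B) (Icc a b) :=
    fun t ht => ⟨le_min ht.1 hab, min_le_right _ _⟩
  have hmin : Continuous fun t : ℝ => min t b := by fun_prop
  obtain ⟨⟨s, hs⟩, h2, h3, h4⟩ := hg
  -- Left continuity of `g` at `b` is what prevents a jump there.
  have hcont : ∀ t, b ≤ t → ContinuousWithinAt (fun t => g (min t b)) (Icc a B) t := by
    intro t ht
    have h4' : ContinuousWithinAt g (Icc a b) (min t b) := by rwa [min_eq_right ht]
    exact ContinuousWithinAt.comp (f := fun t => min t b) h4' hmin.continuousWithinAt hmaps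
  have hright : ∀ t ∈ Ico a B, ContinuousWithinAt (fun t => g (min t b)) (Icc t B) t := by
    intro t ht
    rcases lt_or_ge t b with htb | htb
    · have h2' : ContinuousWithinAt g (Icc t b) (min t b) := by
        rw [min_eq_left htb.le]; exact h2 t ⟨ht.1, htb⟩
      exact ContinuousWithinAt.comp (f := fun t => min t b) h2' hmin.continuousWithinAt
        fun r hr => ⟨le_min hr.1 htb.le, min_le_right _ _⟩
    · exact (hcont t htb).mono (Icc_subset_Icc ht.1 le_rfl)
  refine ⟨⟨s, fun t ht hts => ?_⟩, hright, fun t ht => ?_, ?_⟩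
  · rcases lt_or_ge t b with htb | htb
    · have h2' : ContinuousWithinAt g (Icc a b) (min t b) := by
        rw [min_eq_left htb.le]; exact hs t ⟨ht.1, htb.le⟩ hts
      exact ContinuousWithinAt.comp (f := fun t => min t b) h2' hmin.continuousWithinAt hmaps
    · exact hcont t htb
  · rcases lt_or_ge b t with htb | htb
    · exact ⟨_, (hcont t htb.le).mono_left (nhdsLT_le_nhdsWithin_Icc ht)⟩
    · obtain ⟨l, hl⟩ := h3 t ⟨ht.1, htb⟩
      refine ⟨l, hl.congr' ?_⟩
      filter_upwards [self_mem_nhdsWithin] with r hr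
      rw [min_eq_left ((le_of_lt hr).trans htb)]
  · exact hcont B hbB

end Topology

section Normed

variable {F : Type*} [NormedAddCommGroup F] {g g' : ℝ → F} {a b : ℝ}

theorem add (hab : a ≤ b) (hg : PiecewiseContinuousOn g a b) (hg' : PiecewiseContinuousOn g' a b) :
    PiecewiseContinuousOn (fun t => g t + g' t) a b :=
  (hg.prodMk hg').comp_continuous hab (φ := fun p : F × F => p.1 + p.2) (by fun_prop)

theorem sub (hab : a ≤ b) (hg : PiecewiseContinuousOn g a b) (hg' : PiecewiseContinuousOn g' a b) :
    PiecewiseContinuousOn (fun t => g t - g' t) a b :=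
  (hg.prodMk hg').comp_continuous hab (φ := fun p : F × F => p.1 - p.2) (by fun_prop)

theorem sum {ι : Type*} (s : Finset ι) {G : ι → ℝ → F} (hab : a ≤ b)
    (hG : ∀ i ∈ s, PiecewiseContinuousOn (G i) a b) :
    PiecewiseContinuousOn (fun t => ∑ i ∈ s, G i t) a b := by
  classical
  induction s using Finset.induction_on with
  | empty => simpa using continuousOn_const.piecewiseContinuousOn hab
  | insert i s hi ih =>
    simp only [Finset.sum_insert hi]
    exact (hG i (by simp)).add hab (ih fun j hj => hG j (by simp [hj]))

/-- A half-open interval matches the right-continuous normalisation. The condition `q < b` makes the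
indicator vanish near `b`; for `q = b` left continuity at `b` could fail. -/
theorem indicator_Ico (hab : a ≤ b) (hg : PiecewiseContinuousOn g a b) (p : ℝ) {q : ℝ}
    (hq : q < b) : PiecewiseContinuousOn ((Ico p q).indicator g) a b := by
  classical
  obtain ⟨⟨s, hs⟩, h2, h3, h4⟩ := hg
  have hin : ∀ {l : Filter ℝ}, (∀ᶠ r in l, r ∈ Ico p q) → g =ᶠ[l] (Ico p q).indicator g :=
    fun h => h.mono fun r hr => (indicator_of_mem hr g).symm
  have hout : ∀ {l : Filter ℝ}, (∀ᶠ r in l, r ∉ Ico p q) →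
      (fun _ => (0 : F)) =ᶠ[l] (Ico p q).indicator g :=
    fun h => h.mono fun r hr => (indicator_of_notMem hr g).symm
  have cin : ∀ {S : Set ℝ} {t : ℝ}, t ∈ S → ContinuousWithinAt g S t →
      (∀ᶠ r in 𝓝[S] t, r ∈ Ico p q) → ContinuousWithinAt ((Ico p q).indicator g) S t :=
    fun ht hc h => hc.congr_of_eventuallyEq (hin h).symm ((hin h).symm.self_of_nhdsWithin ht)
  have cout : ∀ {S : Set ℝ} {t : ℝ}, t ∈ S →
      (∀ᶠ r in 𝓝[S] t, r ∉ Ico p q) → ContinuousWithinAt ((Ico p q).indicator g) S t :=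
    fun ht h => (continuousWithinAt_const (b := (0 : F))).congr_of_eventuallyEq
      (hout h).symm ((hout h).symm.self_of_nhdsWithin ht)
  refine ⟨⟨s ∪ {p, q}, fun t ht hts => ?_⟩, fun t ht => ?_, fun t ht => ?_, ?_⟩
  · simp only [Finset.mem_union, Finset.mem_insert, Finset.mem_singleton, not_or] at hts
    rcases lt_or_gt_of_ne hts.2.1 with h | h
    · exact cout ht (eventually_nhdsWithin_of_eventually_nhds
        ((eventually_lt_nhds h).mono fun r hr hr' => hr'.1.not_gt hr))
    rcases lt_or_gt_of_ne hts.2.2 with h' | h'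
    · exact cin ht (hs t ht hts.1) (eventually_nhdsWithin_of_eventually_nhds (Ico_mem_nhds h h'))
    · exact cout ht (eventually_nhdsWithin_of_eventually_nhds
        ((eventually_gt_nhds h').mono fun r hr hr' => hr'.2.not_gt hr))
  · have htt : t ∈ Icc t b := ⟨le_rfl, ht.2.le⟩
    rcases lt_or_ge t p with h | h
    · exact cout htt (eventually_nhdsWithin_of_eventually_nhds
        ((eventually_lt_nhds h).mono fun r hr hr' => hr'.1.not_gt hr))
    rcases lt_or_ge t q with h' | h'
    · refine cin htt (h2 t ht) ?_
      filter_upwards [self_mem_nhdsWithin, mem_nhdsWithin_of_mem_nhds (Iio_mem_nhds h')] with r hr hr'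
      exact ⟨h.trans hr.1, hr'⟩
    · refine cout htt ?_
      filter_upwards [self_mem_nhdsWithin] with r hr hr'
      exact (h'.trans hr.1).not_gt hr'.2
  · rcases le_or_gt t p with h | h
    · exact ⟨0, tendsto_const_nhds.congr' (hout (by
        filter_upwards [self_mem_nhdsWithin] with r hr hr'
        exact (h.trans hr'.1).not_gt hr))⟩
    rcases le_or_gt t q with h' | h'
    · obtain ⟨l, hl⟩ := h3 t ht
      exact ⟨l, hl.congr' (hin (by
        filter_upwards [Ico_mem_nhdsLT h] with r hr
        exact ⟨hr.1, hr.2.trans_le h'⟩))⟩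
    · exact ⟨0, tendsto_const_nhds.congr' (hout (by
        filter_upwards [Ico_mem_nhdsLT h'] with r hr hr'
        exact hr.1.not_gt hr'.2))⟩
  · exact cout ⟨hab, le_rfl⟩ (eventually_nhdsWithin_of_eventually_nhds
      ((eventually_gt_nhds hq).mono fun r hr hr' => hr'.2.not_gt hr))

/-- The left limit and the right continuity at a point bound `g` near it; compactness makes the
bound global. -/
theorem exists_norm_le (hg : PiecewiseContinuousOn g a b) : ∃ C, ∀ t ∈ Icc a b, ‖g t‖ ≤ C := by
  obtain ⟨-, h2, h3, h4⟩ := hg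
  refine isCompact_Icc.induction_on (p := fun s => ∃ C, ∀ t ∈ s, ‖g t‖ ≤ C) ⟨0, by simp⟩
    (fun s t hst ⟨C, hC⟩ => ⟨C, fun r hr => hC r (hst hr)⟩)
    (fun s t ⟨C, hC⟩ ⟨D, hD⟩ => ⟨max C D, fun r hr => hr.elim
      (fun h => (hC r h).trans (le_max_left _ _)) fun h => (hD r h).trans (le_max_right _ _)⟩)
    fun t ht => ?_
  have hr : ∀ᶠ r in 𝓝[Icc t b] t, ‖g r‖ ≤ ‖g t‖ + 1 := by
    have : ContinuousWithinAt g (Icc t b) t := by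
      rcases ht.2.lt_or_eq with h | h
      · exact h2 t ⟨ht.1, h⟩
      · subst h; exact h4.mono (Icc_subset_Icc ht.1 le_rfl)
    exact (this.norm.eventually_lt_const (lt_add_one _)).mono fun _ => le_of_lt
  have : ∃ C, ∀ᶠ r in 𝓝[Icc a b] t, ‖g r‖ ≤ C := by
    rcases ht.1.lt_or_eq with h | h
    · obtain ⟨l, hl⟩ := h3 t ⟨h, ht.2⟩
      have hl' : ∀ᶠ r in 𝓝[<] t, ‖g r‖ ≤ ‖l‖ + 1 :=
        (hl.norm.eventually_lt_const (lt_add_one _)).mono fun _ => le_of_lt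
      refine ⟨max (‖l‖ + 1) (‖g t‖ + 1), (eventually_sup.2 ⟨?_, ?_⟩).filter_mono
        (nhdsWithin_Icc_le_sup a b t)⟩
      · exact hl'.mono fun r hr => hr.trans (le_max_left _ _)
      · exact hr.mono fun r hr => hr.trans (le_max_right _ _)
    · subst h; exact ⟨_, hr⟩
  obtain ⟨C, hC⟩ := this
  exact ⟨_, hC, C, fun r hr => hr⟩

theorem aestronglyMeasurable (hg : PiecewiseContinuousOn g a b) :
    AEStronglyMeasurable g (volume.restrict (Icc a b)) := by
  obtain ⟨⟨s, hs⟩, -⟩ := hg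
  have h1 : AEStronglyMeasurable g (volume.restrict (Icc a b \ s)) :=
    ContinuousOn.aestronglyMeasurable
      (fun t ht => (hs t ht.1 ht.2).mono sdiff_subset)
      (measurableSet_Icc.diff s.measurableSet)
  rwa [Measure.restrict_congr_set (sdiff_null_ae_eq_self (s.finite_toSet.measure_zero _))] at h1

theorem integrableOn (hg : PiecewiseContinuousOn g a b) : IntegrableOn g (Icc a b) := by
  obtain ⟨C, hC⟩ := hg.exists_norm_le
  exact IntegrableOn.of_bound measure_Icc_lt_top hg.aestronglyMeasurable C
    (ae_restrict_of_forall_mem measurableSet_Icc hC)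

theorem intervalIntegrable (hg : PiecewiseContinuousOn g a b) {p q : ℝ} (hp : p ∈ Icc a b)
    (hq : q ∈ Icc a b) : IntervalIntegrable g volume p q :=
  (intervalIntegrable_iff' (by simp)).2 (hg.integrableOn.mono_set (uIcc_subset_Icc hp hq))

theorem continuousOn_integral [NormedSpace ℝ F] (hab : a ≤ b) (hg : PiecewiseContinuousOn g a b) :
    ContinuousOn (fun t => ∫ s in a..t, g s) (Icc a b) := by
  have := intervalIntegral.continuousOn_primitive_interval (f := g) (μ := volume) (a := a) (b := b)
    (by rw [uIcc_of_le hab]; exact hg.integrableOn)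
  rwa [uIcc_of_le hab] at this

theorem continuousWithinAt_Ici (hg : PiecewiseContinuousOn g a b) {t : ℝ} (ht : t ∈ Ico a b) :
    ContinuousWithinAt g (Ici t) t :=
  (hg.2.1 t ht).mono_of_mem_nhdsWithin (Icc_mem_nhdsGE ht.2)

/-- Right continuity yields the right derivative at every point, jumps included; the adjoint
equation inherits its pointwise form from this. -/
theorem hasDerivWithinAt_integral [NormedSpace ℝ F] [CompleteSpace F] (hg : PiecewiseContinuousOn g a b) {t : ℝ}
    (ht : t ∈ Ico a b) {p : ℝ} (hp : p ∈ Icc a b) :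
    HasDerivWithinAt (fun r => ∫ s in p..r, g s) (g t) (Ici t) t :=
  intervalIntegral.integral_hasDerivWithinAt_right
    (hg.intervalIntegrable hp ⟨ht.1, ht.2.le⟩)
    ⟨Icc a b, mem_of_superset (Icc_mem_nhdsGT ht.2) (Icc_subset_Icc ht.1 le_rfl),
      hg.aestronglyMeasurable⟩
    ((hg.continuousWithinAt_Ici ht).mono Ioi_subset_Ici_self)

end Normed

end PiecewiseContinuousOn

/-! ### Fundamental matrix and one-sided averages -/

/-- The backward linear matrix equation `M' = -M A`, `M b = 1`. -/
theorem exists_backward_linear_solution {R : Type*} [NormedRing R] [NormedAlgebra ℝ R]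
    [CompleteSpace R] {a b : ℝ} (hab : a ≤ b) {A : ℝ → R} (hA : PiecewiseContinuousOn A a b) :
    ∃ M : ℝ → R, ContinuousOn M (Icc a b) ∧ M b = 1 ∧
      ∀ t ∈ Ico a b, HasDerivWithinAt M (-(M t * A t)) (Ici t) t := by
  obtain ⟨C, hC⟩ := hA.exists_norm_le
  have hmul : ∀ x : ℝ → R, Continuous x → PiecewiseContinuousOn (fun t => x t * A t) a b :=
    fun x hx => ((hx.continuousOn.piecewiseContinuousOn hab).prodMk hA).comp_continuous hab
      (φ := fun p : R × R => p.1 * p.2) (by fun_prop)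
  have hint : ∀ x : ℝ → R, Continuous x →
      IntervalIntegrable (fun t => x t * A (a + b - t)) volume a b := by
    intro x hx
    have h := ((hmul (fun s => x (a + b - s)) (by fun_prop)).intervalIntegrable
      (right_mem_Icc.2 hab) (left_mem_Icc.2 hab)).comp_sub_left (a + b)
    simpa using h
  -- The reflection `t ↦ a + b - t` turns the terminal condition into an initial one. The reflected
  -- coefficient has its jumps normalised on the wrong side, so only its integrability is used.
  obtain ⟨N, hN, hN'⟩ := exists_integral_solution hab (g := fun t M => M * A (a + b - t))
    (K := C.toNNReal) (fun t ht => LipschitzWith.of_dist_le_mul fun M₁ M₂ => by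
      rw [dist_eq_norm, dist_eq_norm, ← sub_mul, mul_comm]
      refine (norm_mul_le _ _).trans (by
        gcongr
        exact (hC _ ⟨by linarith [ht.2], by linarith [ht.1]⟩).trans (Real.le_coe_toNNReal C)))
    hint 1
  refine ⟨fun t => N (a + b - t), by fun_prop, ?_, fun t ht => ?_⟩
  · have := hN' a ⟨le_rfl, hab⟩
    simpa using this
  · have hp := hmul (fun s => N (a + b - s)) (by fun_prop)
    -- Undoing the reflection gives an integral from `a` to `t` of a correctly normalised integrand,
    -- which has a right derivative everywhere.
    have key : ∀ t ∈ Icc a b, N (a + b - t) =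
        1 + ((∫ s in a..b, N (a + b - s) * A s) - ∫ s in a..t, N (a + b - s) * A s) := by
      intro t ht
      rw [intervalIntegral.integral_interval_sub_left
        (hp.intervalIntegrable ⟨le_rfl, hab⟩ ⟨hab, le_rfl⟩)
        (hp.intervalIntegrable ⟨le_rfl, hab⟩ ht), hN' _ ⟨by linarith [ht.2], by linarith [ht.1]⟩]
      have := intervalIntegral.integral_comp_sub_left (a := a) (b := a + b - t)
        (fun s => N (a + b - s) * A s) (a + b)
      simpa using this
    have hd := ((hp.hasDerivWithinAt_integral ht ⟨le_rfl, hab⟩).const_sub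
      (∫ s in a..b, N (a + b - s) * A s)).const_add 1
    refine hd.congr_of_eventuallyEq ?_ (key t ⟨ht.1, ht.2.le⟩)
    filter_upwards [Icc_mem_nhdsGE ht.2] with s hs
    exact key s ⟨ht.1.trans hs.1, hs.2⟩

/-- First-order averages over shrinking intervals to the right of `τ`. -/
theorem PiecewiseContinuousOn.tendsto_average_right {F : Type*} [NormedAddCommGroup F]
    [NormedSpace ℝ F] [CompleteSpace F] {h : ℝ → F} {a b : ℝ} (hh : PiecewiseContinuousOn h a b)
    {τ : ℝ} (hτ : τ ∈ Ico a b) {p α : ℝ} (hp : 0 ≤ p) (hα : 0 ≤ α) :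
    Tendsto (fun ε : ℝ => ε⁻¹ • ∫ s in (τ + ε * p)..(τ + ε * (p + α)), h s) (𝓝[>] 0)
      (𝓝 (α • h τ)) := by
  have hd := hh.hasDerivWithinAt_integral hτ ⟨hτ.1, hτ.2.le⟩
  have hc : ∀ q : ℝ, 0 ≤ q →
      HasDerivWithinAt (fun ε : ℝ => ∫ s in τ..(τ + ε * q), h s) (q • h τ) (Ici 0) 0 := by
    intro q hq
    have h1 : HasDerivWithinAt (fun ε : ℝ => τ + ε * q) q (Ici 0) 0 := by
      simpa using (((hasDerivAt_id (0 : ℝ)).mul_const q).const_add τ).hasDerivWithinAt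
    have h2 : HasDerivWithinAt (fun r => ∫ s in τ..r, h s) (h τ) (Ici τ) (τ + 0 * q) := by
      simpa using hd
    exact h2.scomp 0 h1 fun ε hε => by
      have : 0 ≤ ε * q := mul_nonneg hε hq
      simpa using this
  have h3 := ((hc (p + α) (by positivity)).sub (hc p hp)).mono Ioi_subset_Ici_self
  rw [hasDerivWithinAt_iff_tendsto_slope' (by simp), ← sub_smul, add_sub_cancel_left] at h3
  refine h3.congr' ?_
  have hev : ∀ᶠ ε : ℝ in 𝓝[>] 0, τ + ε * (p + α) < b := by
    have : Tendsto (fun ε : ℝ => τ + ε * (p + α)) (𝓝[>] 0) (𝓝 (τ + 0 * (p + α))) :=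
      (Continuous.tendsto (by fun_prop) 0).mono_left nhdsWithin_le_nhds
    exact this.eventually_lt_const (by simpa using hτ.2)
  filter_upwards [hev, self_mem_nhdsWithin] with ε hε hε0
  have hε0 : 0 < ε := hε0
  have h0 : 0 ≤ ε * p := by positivity
  have h1 : ε * p ≤ ε * (p + α) := by gcongr; linarith
  have ht : τ ∈ Icc a b := ⟨hτ.1, hτ.2.le⟩
  rw [slope_def_module]
  simp only [Pi.sub_apply, zero_mul, add_zero, intervalIntegral.integral_same, sub_zero]
  rw [intervalIntegral.integral_interval_sub_left
    (hh.intervalIntegrable ht ⟨by linarith [hτ.1], hε.le⟩)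
    (hh.intervalIntegrable ht ⟨by linarith [hτ.1], by linarith⟩)]

/-! ### Controls and trajectories -/

namespace MayerProblem

variable {n m : ℕ} {E I : Type*} (P : MayerProblem n m E I)

/-- `x` is the trajectory of the control `u` on `[t₀, B]`. -/
def IsTrajectory (B : ℝ) (u : ℝ → EuclideanSpace ℝ (Fin m)) (x : ℝ → EuclideanSpace ℝ (Fin n)) :
    Prop :=
  ContinuousOn x (Icc P.t₀ B) ∧
    ∀ t ∈ Icc P.t₀ B, x t = P.x₀ + ∫ s in P.t₀..t, P.f (x s) (u s) s

/-- `u` is a piecewise continuous control on `[t₀, B]` with values in `V`. -/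
def IsControl (B : ℝ) (u : ℝ → EuclideanSpace ℝ (Fin m)) : Prop :=
  PiecewiseContinuousOn u P.t₀ B ∧ ∀ t ∈ Icc P.t₀ B, u t ∈ P.V

variable {P}

theorem IsTrajectory.mono {B B' : ℝ} {u : ℝ → EuclideanSpace ℝ (Fin m)}
    {x : ℝ → EuclideanSpace ℝ (Fin n)} (h : P.IsTrajectory B u x) (hB : B' ≤ B) :
    P.IsTrajectory B' u x :=
  ⟨h.1.mono (Icc_subset_Icc le_rfl hB), fun t ht => h.2 t ⟨ht.1, ht.2.trans hB⟩⟩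

theorem IsTrajectory.apply_left {B : ℝ} {u : ℝ → EuclideanSpace ℝ (Fin m)}
    {x : ℝ → EuclideanSpace ℝ (Fin n)} (h : P.IsTrajectory B u x) (hB : P.t₀ ≤ B) :
    x P.t₀ = P.x₀ := by simpa using h.2 P.t₀ ⟨le_rfl, hB⟩

theorem IsControl.comp (hP : P.Standing) {B : ℝ} (hB : P.t₀ ≤ B)
    {u : ℝ → EuclideanSpace ℝ (Fin m)} (hu : P.IsControl B u)
    {x : ℝ → EuclideanSpace ℝ (Fin n)} (hx : ContinuousOn x (Icc P.t₀ B)) {G : Type*}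
    [TopologicalSpace G] {Φ : EuclideanSpace ℝ (Fin n) → EuclideanSpace ℝ (Fin m) → ℝ → G}
    (hΦ : ContinuousOn
      (fun p : EuclideanSpace ℝ (Fin n) × EuclideanSpace ℝ (Fin m) × ℝ => Φ p.1 p.2.1 p.2.2)
      (univ ×ˢ P.V ×ˢ Ici P.t₀)) :
    PiecewiseContinuousOn (fun t => Φ (x t) (u t) t) P.t₀ B :=
  ((hx.piecewiseContinuousOn hB).prodMk
    (hu.1.prodMk (continuousOn_id.piecewiseContinuousOn hB))).comp_continuousOn hB
    (isClosed_univ.prod (hP.compact_V.isClosed.prod isClosed_Ici))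
    (fun t ht => ⟨mem_univ _, hu.2 t ht, ht.1⟩) hΦ

theorem IsControl.pwc_f (hP : P.Standing) {B : ℝ} (hB : P.t₀ ≤ B)
    {u : ℝ → EuclideanSpace ℝ (Fin m)} (hu : P.IsControl B u)
    {x : ℝ → EuclideanSpace ℝ (Fin n)} (hx : ContinuousOn x (Icc P.t₀ B)) :
    PiecewiseContinuousOn (fun t => P.f (x t) (u t) t) P.t₀ B :=
  hu.comp hP hB hx hP.continuous_f

theorem IsControl.exists_trajectory (hP : P.Standing) {B : ℝ} (hB : P.t₀ ≤ B)
    {u : ℝ → EuclideanSpace ℝ (Fin m)} (hu : P.IsControl B u) : ∃ x, P.IsTrajectory B u x := by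
  obtain ⟨L, hL⟩ := hP.lipschitz_f B
  obtain ⟨x, hx, hx'⟩ := exists_integral_solution hB (g := fun t y => P.f y (u t) t)
    (fun t ht => hL _ (hu.2 t ht) t ht)
    (fun x hx => (hu.pwc_f hP hB hx.continuousOn).intervalIntegrable
      ⟨le_rfl, hB⟩ ⟨hB, le_rfl⟩) P.x₀
  exact ⟨x, hx.continuousOn, hx'⟩

theorem IsTrajectory.hasDerivWithinAt (hP : P.Standing) {B : ℝ} (hB : P.t₀ ≤ B)
    {u : ℝ → EuclideanSpace ℝ (Fin m)} (hu : P.IsControl B u)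
    {x : ℝ → EuclideanSpace ℝ (Fin n)} (hx : P.IsTrajectory B u x) {t : ℝ} (ht : t ∈ Ico P.t₀ B) :
    HasDerivWithinAt x (P.f (x t) (u t) t) (Ici t) t := by
  refine (((hu.pwc_f hP hB hx.1).hasDerivWithinAt_integral ht ⟨le_rfl, hB⟩).const_add
    P.x₀).congr_of_eventuallyEq ?_ (hx.2 t ⟨ht.1, ht.2.le⟩)
  filter_upwards [Icc_mem_nhdsGE ht.2] with s hs
  exact hx.2 s ⟨ht.1.trans hs.1, hs.2⟩

/-- Continuous dependence of the trajectory on the control. -/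
theorem IsTrajectory.norm_sub_le (hP : P.Standing) {B : ℝ} (hB : P.t₀ ≤ B) {L : NNReal}
    (hL : ∀ u ∈ P.V, ∀ t ∈ Icc P.t₀ B, LipschitzWith L (fun x => P.f x u t))
    {u₁ u₂ : ℝ → EuclideanSpace ℝ (Fin m)} (hu₁ : P.IsControl B u₁) (hu₂ : P.IsControl B u₂)
    {x₁ x₂ : ℝ → EuclideanSpace ℝ (Fin n)} (hx₁ : P.IsTrajectory B u₁ x₁)
    (hx₂ : P.IsTrajectory B u₂ x₂) {κ : ℝ}
    (hκ : ∀ t ∈ Icc P.t₀ B,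
      ‖∫ s in P.t₀..t, (P.f (x₁ s) (u₂ s) s - P.f (x₁ s) (u₁ s) s)‖ ≤ κ) :
    ∀ t ∈ Icc P.t₀ B, ‖x₂ t - x₁ t‖ ≤ κ * Real.exp ((L + 1) * (B - P.t₀)) := by
  have hκ0 : 0 ≤ κ := (norm_nonneg _).trans (hκ _ ⟨le_rfl, hB⟩)
  have p11 := hu₁.pwc_f hP hB hx₁.1
  have p12 := hu₂.pwc_f hP hB hx₁.1
  have p22 := hu₂.pwc_f hP hB hx₂.1
  have hsub := p22.sub hB p12
  -- Gronwall is applied to `w` and not to `x₂ - x₁`: the control perturbation is small only after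
  -- integration, while the integrand of `w` is bounded by the state difference.
  set w : ℝ → EuclideanSpace ℝ (Fin n) :=
    fun t => ∫ s in P.t₀..t, (P.f (x₂ s) (u₂ s) s - P.f (x₁ s) (u₂ s) s) with hw
  have hl : P.t₀ ∈ Icc P.t₀ B := ⟨le_rfl, hB⟩
  have hy : ∀ t ∈ Icc P.t₀ B, ‖x₂ t - x₁ t‖ ≤ ‖w t‖ + κ := by
    intro t ht
    have : x₂ t - x₁ t =
        w t + ∫ s in P.t₀..t, (P.f (x₁ s) (u₂ s) s - P.f (x₁ s) (u₁ s) s) := by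
      rw [hx₂.2 t ht, hx₁.2 t ht, hw]
      simp only
      rw [intervalIntegral.integral_sub (p22.intervalIntegrable hl ht)
        (p12.intervalIntegrable hl ht), intervalIntegral.integral_sub
        (p12.intervalIntegrable hl ht) (p11.intervalIntegrable hl ht)]
      abel
    rw [this]
    exact (norm_add_le _ _).trans (by gcongr; exact hκ t ht)
  -- The rate `L + 1` is nonzero, which selects the exponential formula for the Gronwall bound.
  have hg := norm_le_gronwallBound_of_norm_deriv_right_le (f := w) (δ := 0) (K := L + 1)
    (ε := (L + 1) * κ) (hsub.continuousOn_integral hB)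
    (fun t ht => hsub.hasDerivWithinAt_integral ht hl) (by simp [hw]) (fun t ht => by
      have ht' : t ∈ Icc P.t₀ B := ⟨ht.1, ht.2.le⟩
      rw [← dist_eq_norm]
      refine ((hL _ (hu₂.2 t ht') t ht').dist_le_mul _ _).trans ?_
      rw [dist_eq_norm, ← mul_add]
      gcongr
      · linarith
      · exact hy t ht')
  intro t ht
  have hk : (L + 1 : ℝ) ≠ 0 := by positivity
  have h1 := hg t ht
  simp only [gronwallBound_of_K_ne_0 hk, zero_mul, zero_add, mul_div_cancel_left₀ _ hk] at h1
  calc ‖x₂ t - x₁ t‖ ≤ ‖w t‖ + κ := hy t ht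
    _ ≤ κ * (Real.exp ((L + 1) * (t - P.t₀)) - 1) + κ := by gcongr
    _ = κ * Real.exp ((L + 1) * (t - P.t₀)) := by ring
    _ ≤ _ := by gcongr; exact ht.2

end MayerProblem

/-! ### First variation of the end point -/

namespace MayerProblem

variable {n m : ℕ} {E I : Type*} {P : MayerProblem n m E I}

theorem IsControl.pwc_fx (hP : P.Standing) {B : ℝ} (hB : P.t₀ ≤ B)
    {u : ℝ → EuclideanSpace ℝ (Fin m)} (hu : P.IsControl B u)
    {x : ℝ → EuclideanSpace ℝ (Fin n)} (hx : ContinuousOn x (Icc P.t₀ B)) :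
    PiecewiseContinuousOn (fun t => P.fx (x t) (u t) t) P.t₀ B :=
  hu.comp hP hB hx hP.continuous_fx

/-- The first variation of the end point, through the fundamental matrix `M` of the adjoint
equation. -/
theorem tendsto_first_variation (hP : P.Standing) {T : ℝ} (hT : P.t₀ ≤ T)
    {u₀ : ℝ → EuclideanSpace ℝ (Fin m)} {x₀ : ℝ → EuclideanSpace ℝ (Fin n)}
    (hu₀ : P.IsControl T u₀) (hx₀ : P.IsTrajectory T u₀ x₀)
    {M : ℝ → EuclideanSpace ℝ (Fin n) →L[ℝ] EuclideanSpace ℝ (Fin n)}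
    (hM : ContinuousOn M (Icc P.t₀ T)) (hMT : M T = 1)
    (hM' : ∀ t ∈ Ico P.t₀ T, HasDerivWithinAt M (-(M t * P.fx (x₀ t) (u₀ t) t)) (Ici t) t)
    {u : ℝ → ℝ → EuclideanSpace ℝ (Fin m)} {x : ℝ → ℝ → EuclideanSpace ℝ (Fin n)}
    (hu : ∀ᶠ ε in 𝓝[>] 0, P.IsControl T (u ε)) (hx : ∀ᶠ ε in 𝓝[>] 0, P.IsTrajectory T (u ε) (x ε))
    {C : ℝ} (hC : ∀ᶠ ε in 𝓝[>] (0 : ℝ), ∀ t ∈ Icc P.t₀ T, ‖x ε t - x₀ t‖ ≤ C * ε)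
    (hae : ∀ᵐ t : ℝ, ∀ᶠ ε in 𝓝[>] 0, u ε t = u₀ t) {d : EuclideanSpace ℝ (Fin n)}
    (hd : Tendsto (fun ε : ℝ => ε⁻¹ • ∫ t in P.t₀..T,
      M t (P.f (x₀ t) (u ε t) t - P.f (x₀ t) (u₀ t) t)) (𝓝[>] 0) (𝓝 d)) :
    Tendsto (fun ε : ℝ => ε⁻¹ • (x ε T - x₀ T)) (𝓝[>] 0) (𝓝 d) := by
  obtain ⟨L, hL⟩ := hP.lipschitz_f T
  set A : ℝ → EuclideanSpace ℝ (Fin n) →L[ℝ] EuclideanSpace ℝ (Fin n) :=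
    fun t => P.fx (x₀ t) (u₀ t) t with hAdef
  have hA : PiecewiseContinuousOn A P.t₀ T := hu₀.pwc_fx hP hT hx₀.1
  have hMp : PiecewiseContinuousOn M P.t₀ T := hM.piecewiseContinuousOn hT
  obtain ⟨CA, hCA⟩ := hA.exists_norm_le
  obtain ⟨CM, hCM⟩ := hMp.exists_norm_le
  have hl : P.t₀ ∈ Icc P.t₀ T := ⟨le_rfl, hT⟩
  have hr : T ∈ Icc P.t₀ T := ⟨hT, le_rfl⟩
  have hCA0 : 0 ≤ CA := (norm_nonneg _).trans (hCA _ hl)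
  have hCM0 : 0 ≤ CM := (norm_nonneg _).trans (hCM _ hl)
  let D : ℝ → ℝ → EuclideanSpace ℝ (Fin n) :=
    fun ε t => M t (P.f (x₀ t) (u ε t) t - P.f (x₀ t) (u₀ t) t)
  -- In the derivative of `M (x ε - x₀)` the term `M A (x ε - x₀)` cancels against `M' = -M A`. What
  -- is left is the control increment `D` and this linearisation error.
  let R : ℝ → ℝ → EuclideanSpace ℝ (Fin n) := fun ε t =>
    M t (P.f (x ε t) (u ε t) t - P.f (x₀ t) (u ε t) t - A t (x ε t - x₀ t))
  have happ : ∀ {M : ℝ → EuclideanSpace ℝ (Fin n) →L[ℝ] EuclideanSpace ℝ (Fin n)}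
      {y : ℝ → EuclideanSpace ℝ (Fin n)}, PiecewiseContinuousOn M P.t₀ T →
      PiecewiseContinuousOn y P.t₀ T → PiecewiseContinuousOn (fun t => M t (y t)) P.t₀ T :=
    fun hM hy => (hM.prodMk hy).comp_continuous hT (φ := fun p => p.1 p.2)
      (isBoundedBilinearMap_apply.continuous)
  have hDR : ∀ᶠ ε in 𝓝[>] (0 : ℝ), PiecewiseContinuousOn (D ε) P.t₀ T ∧
      PiecewiseContinuousOn (R ε) P.t₀ T := by
    filter_upwards [hu, hx] with ε hu hx
    refine ⟨happ hMp ((hu.pwc_f hP hT hx₀.1).sub hT (hu₀.pwc_f hP hT hx₀.1)), happ hMp ?_⟩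
    exact ((hu.pwc_f hP hT hx.1).sub hT (hu.pwc_f hP hT hx₀.1)).sub hT
      (happ hA ((hx.1.sub hx₀.1).piecewiseContinuousOn hT))
  have hform : ∀ᶠ ε in 𝓝[>] (0 : ℝ), x ε T - x₀ T =
      (∫ t in P.t₀..T, D ε t) + ∫ t in P.t₀..T, R ε t := by
    filter_upwards [hu, hx, hDR] with ε hu hx hDR
    have hsum := hDR.1.add hT hDR.2
    have hFTC := intervalIntegral.integral_eq_sub_of_hasDeriv_right_of_le hT
      (f := fun t => M t (x ε t - x₀ t)) (f' := fun t => D ε t + R ε t)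
      (hM.clm_apply (hx.1.sub hx₀.1)) (fun t ht => by
        have ht' : t ∈ Ico P.t₀ T := ⟨ht.1.le, ht.2⟩
        have h := (hM' t ht').clm_apply
          ((hx.hasDerivWithinAt hP hT hu ht').sub (hx₀.hasDerivWithinAt hP hT hu₀ ht'))
        refine (h.mono Ioi_subset_Ici_self).congr_deriv ?_
        have hmul : ∀ z, (M t * P.fx (x₀ t) (u₀ t) t) z = M t (P.fx (x₀ t) (u₀ t) t z) :=
          fun _ => rfl
        simp only [D, R, hAdef, neg_apply, hmul, map_sub, Pi.sub_apply]
        abel)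
      (hsum.intervalIntegrable hl hr)
    rw [intervalIntegral.integral_add (hDR.1.intervalIntegrable hl hr)
      (hDR.2.intervalIntegrable hl hr)] at hFTC
    rw [hFTC, hMT, hx.apply_left hT, hx₀.apply_left hT]
    simp
  -- Dominated convergence: `R / ε` is bounded by the Lipschitz estimate. For almost every `t` the
  -- control is eventually `u₀ t`, so that differentiability of `f` in the state gives `o(ε)`.
  have hRlim : Tendsto (fun ε : ℝ => ∫ t in P.t₀..T, ε⁻¹ • R ε t) (𝓝[>] 0)
      (𝓝 (∫ t in P.t₀..T, (0 : EuclideanSpace ℝ (Fin n)))) := by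
    refine intervalIntegral.tendsto_integral_filter_of_dominated_convergence
      (fun _ => CM * ((L + CA) * C)) ?_ ?_ (by simp) ?_
    · filter_upwards [hDR] with ε h
      exact ((h.2.intervalIntegrable hl hr).def'.aestronglyMeasurable).const_smul ε⁻¹
    · filter_upwards [hC, hu, self_mem_nhdsWithin] with ε hC hu (hε : 0 < ε)
      refine Eventually.of_forall fun t ht => ?_
      rw [uIoc_of_le hT] at ht
      have ht' : t ∈ Icc P.t₀ T := ⟨ht.1.le, ht.2⟩
      rw [norm_smul, norm_inv, Real.norm_eq_abs, abs_of_pos hε, inv_mul_le_iff₀ hε]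
      have h1 : ‖P.f (x ε t) (u ε t) t - P.f (x₀ t) (u ε t) t‖ ≤ L * (C * ε) := by
        rw [← dist_eq_norm]
        refine ((hL _ (hu.2 t ht') t ht').dist_le_mul _ _).trans ?_
        rw [dist_eq_norm]
        gcongr
        exact hC t ht'
      have h2 : ‖A t (x ε t - x₀ t)‖ ≤ CA * (C * ε) :=
        (A t).le_of_opNorm_le_of_le (hCA t ht') (hC t ht')
      refine ((M t).le_of_opNorm_le_of_le (hCM t ht') ((norm_sub_le _ _).trans
        (add_le_add h1 h2))).trans (le_of_eq (by ring))
    · filter_upwards [hae] with t hae ht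
      rw [uIoc_of_le hT] at ht
      have ht' : t ∈ Icc P.t₀ T := ⟨ht.1.le, ht.2⟩
      have hO : (fun ε => x ε t - x₀ t) =O[𝓝[>] 0] fun ε : ℝ => ε := by
        refine Asymptotics.IsBigO.of_bound C ?_
        filter_upwards [hC, self_mem_nhdsWithin] with ε hC (hε : 0 < ε)
        rw [Real.norm_eq_abs, abs_of_pos hε]
        exact hC t ht'
      have hid : Tendsto (fun ε : ℝ => ε) (𝓝[>] 0) (𝓝 0) := nhdsWithin_le_nhds
      have hlim : Tendsto (fun ε => x ε t) (𝓝[>] 0) (𝓝 (x₀ t)) := by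
        have := (hO.trans_tendsto hid).add_const (x₀ t)
        simpa using this
      have hdiff : HasFDerivAt (fun y => P.f y (u₀ t) t) (A t) (x₀ t) :=
        (hP.differentiable_f _ _ (hu₀.2 t ht') t ht'.1).hasFDerivAt
      have ho := (hdiff.isLittleO.comp_tendsto hlim).trans_isBigO hO
      have ho' : (fun ε => R ε t) =o[𝓝[>] 0] fun ε : ℝ => ε := by
        refine (((M t).isBigO_comp _ _).trans_isLittleO ho).congr' ?_ EventuallyEq.rfl
        filter_upwards [hae] with ε h
        simp only [R, h, Function.comp_apply]
      exact ho'.tendsto_inv_smul_nhds_zero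
  have hfin := hd.add hRlim
  rw [intervalIntegral.integral_zero, add_zero] at hfin
  refine hfin.congr' ?_
  filter_upwards [hform] with ε h
  rw [h, smul_add, intervalIntegral.integral_smul]

end MayerProblem

/-! ### Needle variations -/

theorem intervalIntegral_indicator_Ico {F : Type*} [NormedAddCommGroup F] [NormedSpace ℝ F]
    (h : ℝ → F) {a b p q : ℝ} (hap : a ≤ p) (hpq : p ≤ q) (hqb : q ≤ b) :
    ∫ t in a..b, (Ico p q).indicator h t = ∫ t in p..q, h t := by
  rw [intervalIntegral.integral_of_le (hap.trans (hpq.trans hqb)), ← integral_Icc_eq_integral_Ioc,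
    setIntegral_indicator measurableSet_Ico, inter_eq_right.2
      (show Ico p q ⊆ Icc a b from fun t ht => ⟨hap.trans ht.1, ht.2.le.trans hqb⟩), integral_Ico_eq_integral_Ioc,
    ← intervalIntegral.integral_of_le hpq]

/-- There are finitely many exceptional points, so near `T` every other point is a continuity point.
This permits terminal times on both sides of `T`. -/
theorem PiecewiseContinuousOn.eventually_restrict_right {F : Type*} [TopologicalSpace F]
    {g : ℝ → F} {a b T : ℝ} (hg : PiecewiseContinuousOn g a b) (hT : T ∈ Ioo a b)
    (hc : ContinuousAt g T) : ∀ᶠ r in 𝓝 T, PiecewiseContinuousOn g a r := by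
  obtain ⟨s, hs⟩ := hg.1
  have h1 : ∀ᶠ r in 𝓝 T, r ∈ ((s : Set ℝ) \ {T})ᶜ :=
    ((s.finite_toSet.sdiff).isClosed.isOpen_compl).mem_nhds (by simp)
  filter_upwards [h1, Ioo_mem_nhds hT.1 hT.2] with r hr hr'
  refine hg.restrict_right hr'.2.le ?_
  by_cases hrT : r = T
  · subst hrT; exact hc.continuousWithinAt
  · exact (hs r ⟨hr'.1.le, hr'.2.le⟩ fun h => hr ⟨h, hrT⟩).mono (Icc_subset_Icc le_rfl hr'.2.le)

section Needles

variable {N : ℕ} {U : Type*} [NormedAddCommGroup U] (τ α : Fin N → ℝ) (v : Fin N → U)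

/-- The delay of the `i`-th needle, which keeps needles at the same time disjoint. -/
def needleOffset (i : Fin N) : ℝ := ∑ j ∈ Finset.Iio i, α j

/-- The interval on which the `i`-th needle of size `ε` acts. -/
def needleInterval (ε : ℝ) (i : Fin N) : Set ℝ :=
  Ico (τ i + ε * needleOffset α i) (τ i + ε * (needleOffset α i + α i))

/-- The control `u₀`, replaced by `v i` on the `i`-th needle interval. -/
def needleControl (u₀ : ℝ → U) (ε t : ℝ) : U :=
  u₀ t + ∑ i, (needleInterval τ α ε i).indicator (fun t => v i - u₀ t) t

variable {τ α v}

theorem needleOffset_nonneg (hα : ∀ i, 0 ≤ α i) (i : Fin N) : 0 ≤ needleOffset α i :=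
  Finset.sum_nonneg fun j _ => hα j

theorem needleOffset_add_le (hα : ∀ i, 0 ≤ α i) {i j : Fin N} (hij : i < j) :
    needleOffset α i + α i ≤ needleOffset α j := by
  have h : insert i (Finset.Iio i) ⊆ Finset.Iio j := by
    intro k hk
    simp only [Finset.mem_insert, Finset.mem_Iio] at hk ⊢
    exact hk.elim (fun h => h ▸ hij) fun h => h.trans hij
  have := Finset.sum_le_sum_of_subset_of_nonneg h fun k _ _ => hα k
  rw [Finset.sum_insert (by simp)] at this
  simp only [needleOffset]
  linarith

theorem eventually_add_mul_lt_add_mul {p q : ℝ} (hpq : p < q) (c d : ℝ) :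
    ∀ᶠ ε : ℝ in 𝓝[>] 0, p + ε * c < q + ε * d := by
  have h1 : Tendsto (fun ε : ℝ => p + ε * c) (𝓝[>] 0) (𝓝 (p + 0 * c)) :=
    (Continuous.tendsto (by fun_prop) 0).mono_left nhdsWithin_le_nhds
  have h2 : Tendsto (fun ε : ℝ => q + ε * d) (𝓝[>] 0) (𝓝 (q + 0 * d)) :=
    (Continuous.tendsto (by fun_prop) 0).mono_left nhdsWithin_le_nhds
  exact h1.eventually_lt h2 (by simpa using hpq)

/-- Needles at distinct times separate for small `ε`; those at a common time are stacked one after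
another by their offsets. -/
theorem eventually_disjoint_needleInterval (hα : ∀ i, 0 ≤ α i) :
    ∀ᶠ ε in 𝓝[>] (0 : ℝ), ∀ i j, i < j →
      Disjoint (needleInterval τ α ε i) (needleInterval τ α ε j) := by
  refine eventually_all.2 fun i => eventually_all.2 fun j => eventually_imp_distrib_left.2 fun hij => ?_
  rcases lt_trichotomy (τ i) (τ j) with h | h | h
  · filter_upwards [eventually_add_mul_lt_add_mul h (needleOffset α i + α i) (needleOffset α j)]
      with ε hε
    exact Set.disjoint_left.2 fun t ht ht' => by linarith [ht.2, ht'.1]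
  · filter_upwards [self_mem_nhdsWithin] with ε (hε : 0 < ε)
    refine Set.disjoint_left.2 fun t ht ht' => ?_
    have := mul_le_mul_of_nonneg_left (needleOffset_add_le hα hij) hε.le
    linarith [ht.2, ht'.1]
  · filter_upwards [eventually_add_mul_lt_add_mul h (needleOffset α j + α j) (needleOffset α i)]
      with ε hε
    exact Set.disjoint_left.2 fun t ht ht' => by linarith [ht.1, ht'.2]

theorem needleControl_of_forall_notMem {u₀ : ℝ → U} {ε t : ℝ}
    (h : ∀ i, t ∉ needleInterval τ α ε i) : needleControl τ α v u₀ ε t = u₀ t := by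
  simp [needleControl, h]

theorem needleControl_of_mem {u₀ : ℝ → U} {ε t : ℝ}
    (hd : ∀ i j, i < j → Disjoint (needleInterval τ α ε i) (needleInterval τ α ε j)) {i : Fin N}
    (h : t ∈ needleInterval τ α ε i) :
    needleControl τ α v u₀ ε t = v i ∧ ∀ j, j ≠ i → t ∉ needleInterval τ α ε j := by
  have hn : ∀ j, j ≠ i → t ∉ needleInterval τ α ε j := fun j hji hj => by
    rcases lt_or_gt_of_ne hji with h' | h'
    · exact Set.disjoint_left.1 (hd j i h') hj h
    · exact Set.disjoint_left.1 (hd i j h') h hj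
  refine ⟨?_, hn⟩
  rw [needleControl, Finset.sum_eq_single i (fun j _ hj => indicator_of_notMem (hn j hj) _)
    (fun h => absurd (Finset.mem_univ i) h), indicator_of_mem h]
  abel

/-- A function of the needle control differs from that of `u₀` by its increments on the needles. -/
theorem apply_needleControl_sub {G : Type*} [AddCommGroup G] {u₀ : ℝ → U} {ε : ℝ}
    (hd : ∀ i j, i < j → Disjoint (needleInterval τ α ε i) (needleInterval τ α ε j)) (t : ℝ)
    (g : U → ℝ → G) :
    g (needleControl τ α v u₀ ε t) t - g (u₀ t) t =
      ∑ i, (needleInterval τ α ε i).indicator (fun t => g (v i) t - g (u₀ t) t) t := by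
  by_cases h : ∃ i, t ∈ needleInterval τ α ε i
  · obtain ⟨i, hi⟩ := h
    obtain ⟨h1, h2⟩ := needleControl_of_mem (v := v) (u₀ := u₀) hd hi
    rw [h1, Finset.sum_eq_single i (fun j _ hj => indicator_of_notMem (h2 j hj) _)
      (fun h => absurd (Finset.mem_univ i) h), indicator_of_mem hi]
  · push Not at h
    rw [needleControl_of_forall_notMem h]
    simp [h]

/-- The needles shrink to the finitely many points `τ i`, so any other time eventually lies outside
all of them. -/
theorem ae_eventually_needleControl_eq (hα : ∀ i, 0 ≤ α i) (u₀ : ℝ → U) :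
    ∀ᵐ t : ℝ, ∀ᶠ ε in 𝓝[>] (0 : ℝ), needleControl τ α v u₀ ε t = u₀ t := by
  filter_upwards [(finite_range τ).countable.ae_notMem volume] with t ht
  have : ∀ᶠ ε in 𝓝[>] (0 : ℝ), ∀ i, t ∉ needleInterval τ α ε i := by
    refine eventually_all.2 fun i => ?_
    rcases lt_or_gt_of_ne (show t ≠ τ i from fun h => ht ⟨i, h.symm⟩) with h | h
    · filter_upwards [self_mem_nhdsWithin] with ε (hε : 0 < ε) ht
      have := mul_nonneg hε.le (needleOffset_nonneg hα i)
      linarith [ht.1]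
    · filter_upwards [eventually_add_mul_lt_add_mul h (needleOffset α i + α i) 0] with ε hε ht
      linarith [ht.2]
  exact this.mono fun ε h => needleControl_of_forall_notMem h

end Needles

/-! ### Trajectories under needle and terminal-time variations -/

namespace MayerProblem

variable {n m : ℕ} {E I : Type*} {P : MayerProblem n m E I}

theorem IsControl.needleControl {N : ℕ} {τ α : Fin N → ℝ} {v : Fin N → EuclideanSpace ℝ (Fin m)}
    {B ε : ℝ} (hB : P.t₀ ≤ B) {u₀ : ℝ → EuclideanSpace ℝ (Fin m)} (hu₀ : P.IsControl B u₀)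
    (hv : ∀ i, v i ∈ P.V)
    (hd : ∀ i j, i < j → Disjoint (needleInterval τ α ε i) (needleInterval τ α ε j))
    (hend : ∀ i, τ i + ε * (needleOffset α i + α i) < B) :
    P.IsControl B (needleControl τ α v u₀ ε) := by
  refine ⟨hu₀.1.add hB (PiecewiseContinuousOn.sum _ hB fun i _ =>
    ((continuousOn_const.piecewiseContinuousOn hB).sub hB hu₀.1).indicator_Ico hB _ (hend i)),
    fun t ht => ?_⟩
  by_cases h : ∃ i, t ∈ needleInterval τ α ε i
  · obtain ⟨i, hi⟩ := h
    rw [(needleControl_of_mem hd hi).1]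
    exact hv i
  · push Not at h
    rw [needleControl_of_forall_notMem h]
    exact hu₀.2 t ht

theorem isControl_const {v : EuclideanSpace ℝ (Fin m)} (hv : v ∈ P.V) {B : ℝ} (hB : P.t₀ ≤ B) :
    P.IsControl B fun _ => v :=
  ⟨continuousOn_const.piecewiseContinuousOn hB, fun _ _ => hv⟩

/-- Needle variations of a reference control, together with a variation of the terminal time. -/
theorem exists_needle_variation (hP : P.Standing) {T B : ℝ} (hT : P.t₀ < T) (hTB : T < B)
    {u₀ : ℝ → EuclideanSpace ℝ (Fin m)} {x₀ : ℝ → EuclideanSpace ℝ (Fin n)}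
    (hu₀ : P.IsControl B u₀) (huT : ContinuousAt u₀ T) (hx₀ : P.IsTrajectory B u₀ x₀)
    {M : ℝ → EuclideanSpace ℝ (Fin n) →L[ℝ] EuclideanSpace ℝ (Fin n)}
    (hM : ContinuousOn M (Icc P.t₀ T)) (hMT : M T = 1)
    (hM' : ∀ t ∈ Ico P.t₀ T, HasDerivWithinAt M (-(M t * P.fx (x₀ t) (u₀ t) t)) (Ici t) t)
    {N : ℕ} {τ α : Fin N → ℝ} {v : Fin N → EuclideanSpace ℝ (Fin m)}
    (hτ : ∀ i, τ i ∈ Ico P.t₀ T) (hα : ∀ i, 0 ≤ α i) (hv : ∀ i, v i ∈ P.V) (β : ℝ) :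
    ∃ (u : ℝ → ℝ → EuclideanSpace ℝ (Fin m)) (x : ℝ → ℝ → EuclideanSpace ℝ (Fin n)) (C : ℝ),
      (∀ᶠ ε in 𝓝[>] (0 : ℝ), T + ε * β ∈ Ioo P.t₀ B) ∧
      (∀ᶠ ε in 𝓝[>] 0, P.IsControl (T + ε * β) (u ε)) ∧
      (∀ᶠ ε in 𝓝[>] 0, P.IsTrajectory (T + ε * β) (u ε) (x ε)) ∧
      (∀ᵐ t : ℝ, ∀ᶠ ε in 𝓝[>] 0, u ε t = u₀ t) ∧
      (∀ᶠ ε in 𝓝[>] (0 : ℝ), ∀ t ∈ Icc P.t₀ B, ‖x ε t - x₀ t‖ ≤ C * ε) ∧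
      Tendsto (fun ε : ℝ => ε⁻¹ • (x ε (T + ε * β) - x₀ T)) (𝓝[>] 0)
        (𝓝 ((∑ i, α i • M (τ i) (P.f (x₀ (τ i)) (v i) (τ i) - P.f (x₀ (τ i)) (u₀ (τ i)) (τ i)))
          + β • P.f (x₀ T) (u₀ T) T)) := by
  have hB : P.t₀ ≤ B := (hT.trans hTB).le
  have hlB : P.t₀ ∈ Icc P.t₀ B := ⟨le_rfl, hB⟩
  have hlT : P.t₀ ∈ Icc P.t₀ T := ⟨le_rfl, hT.le⟩
  have hrT : T ∈ Icc P.t₀ T := ⟨hT.le, le_rfl⟩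
  have hTB' : T ∈ Icc P.t₀ B := ⟨hT.le, hTB.le⟩
  obtain ⟨L, hL⟩ := hP.lipschitz_f B
  have hPW : ∀ᶠ r in 𝓝 T, P.IsControl r u₀ := by
    filter_upwards [hu₀.1.eventually_restrict_right ⟨hT, hTB⟩ huT, Iio_mem_nhds hTB] with r hr hr'
    exact ⟨hr, fun t ht => hu₀.2 t ⟨ht.1, ht.2.trans (le_of_lt hr')⟩⟩
  have hTlim : Tendsto (fun ε : ℝ => T + ε * β) (𝓝[>] 0) (𝓝 T) := by
    have : Tendsto (fun ε : ℝ => T + ε * β) (𝓝[>] 0) (𝓝 (T + 0 * β)) :=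
      (Continuous.tendsto (by fun_prop) 0).mono_left nhdsWithin_le_nhds
    simpa using this
  set u := needleControl τ α v u₀ with hudef
  have hdisj := eventually_disjoint_needleInterval (τ := τ) hα
  have hend : ∀ᶠ ε in 𝓝[>] (0 : ℝ), ∀ i, τ i + ε * (needleOffset α i + α i) < T ∧
      τ i + ε * (needleOffset α i + α i) < T + ε * β :=
    eventually_all.2 fun i => by
      filter_upwards [eventually_add_mul_lt_add_mul (hτ i).2 (needleOffset α i + α i) 0,
        eventually_add_mul_lt_add_mul (hτ i).2 (needleOffset α i + α i) β] with ε h1 h2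
      exact ⟨by simpa using h1, h2⟩
  have hTmem : ∀ᶠ ε in 𝓝[>] (0 : ℝ), T + ε * β ∈ Ioo P.t₀ B :=
    hTlim (Ioo_mem_nhds hT hTB)
  have huB : ∀ᶠ ε in 𝓝[>] 0, P.IsControl B (u ε) := by
    filter_upwards [hdisj, hend] with ε h1 h2
    exact hu₀.needleControl hB hv h1 fun i => (h2 i).1.trans hTB
  have huT' : ∀ᶠ ε in 𝓝[>] 0, P.IsControl T (u ε) := by
    filter_upwards [hdisj, hend] with ε h1 h2
    exact hPW.self_of_nhds.needleControl hT.le hv h1 fun i => (h2 i).1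
  have huTe : ∀ᶠ ε in 𝓝[>] 0, P.IsControl (T + ε * β) (u ε) := by
    filter_upwards [hdisj, hend, hTmem, hTlim.eventually hPW] with ε h1 h2 h3 h4
    exact h4.needleControl h3.1.le hv h1 fun i => (h2 i).2
  -- Trajectories are taken on the fixed interval up to `B`, which contains both `T` and `T + ε * β`
  -- for small `ε`. The value `0` is a dummy where `u ε` is not a control.
  have hex : ∀ ε, ∃ x, P.IsControl B (u ε) → P.IsTrajectory B (u ε) x := fun ε => by
    by_cases h : P.IsControl B (u ε)
    · obtain ⟨x, hx⟩ := h.exists_trajectory hP hB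
      exact ⟨x, fun _ => hx⟩
    · exact ⟨0, fun h' => absurd h' h⟩
  choose x hx' using hex
  have hx : ∀ᶠ ε in 𝓝[>] 0, P.IsTrajectory B (u ε) (x ε) := huB.mono fun ε h => hx' ε h
  have hae := ae_eventually_needleControl_eq (τ := τ) (v := v) hα u₀
  -- increments
  have pinc : ∀ i, PiecewiseContinuousOn
      (fun t => P.f (x₀ t) (v i) t - P.f (x₀ t) (u₀ t) t) P.t₀ B := fun i =>
    ((isControl_const (hv i) hB).pwc_f hP hB hx₀.1).sub hB (hu₀.pwc_f hP hB hx₀.1)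
  have hKex : ∃ K : ℝ, 0 ≤ K ∧ ∀ i, ∀ t ∈ Icc P.t₀ B,
      ‖P.f (x₀ t) (v i) t - P.f (x₀ t) (u₀ t) t‖ ≤ K := by
    choose K hK using fun i => (pinc i).exists_norm_le
    refine ⟨∑ i, |K i|, Finset.sum_nonneg fun i _ => abs_nonneg _, fun i t ht => ?_⟩
    exact (hK i t ht).trans ((le_abs_self _).trans
      (Finset.single_le_sum (f := fun i => |K i|) (fun i _ => abs_nonneg _) (Finset.mem_univ i)))
  obtain ⟨K, hK0, hK⟩ := hKex
  -- The needles have total length `ε * ∑ α i`, `K` bounds the increments of `f` on them, and the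
  -- exponential is the Gronwall factor.
  set C : ℝ := (∑ i, α i * K) * Real.exp ((L + 1) * (B - P.t₀)) with hCdef
  have hpos : ∀ ε : ℝ, 0 < ε → ∀ i, P.t₀ ≤ τ i + ε * needleOffset α i ∧
      τ i + ε * needleOffset α i ≤ τ i + ε * (needleOffset α i + α i) := fun ε hε i =>
    ⟨by linarith [(hτ i).1, mul_nonneg hε.le (needleOffset_nonneg hα i)],
      by linarith [mul_nonneg hε.le (hα i)]⟩
  have hC : ∀ᶠ ε in 𝓝[>] (0 : ℝ), ∀ t ∈ Icc P.t₀ B, ‖x ε t - x₀ t‖ ≤ C * ε := by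
    filter_upwards [hdisj, hend, huB, hx, self_mem_nhdsWithin] with ε hd he hu hx (hε : 0 < ε)
    have hend' : ∀ i, τ i + ε * (needleOffset α i + α i) < B := fun i => (he i).1.trans hTB
    have hpwb : ∀ i, PiecewiseContinuousOn
        ((needleInterval τ α ε i).indicator fun _ => K) P.t₀ B := fun i =>
      (continuousOn_const.piecewiseContinuousOn hB).indicator_Ico hB _ (hend' i)
    have hpwS : PiecewiseContinuousOn
        (fun s => ∑ i, (needleInterval τ α ε i).indicator (fun _ => K) s) P.t₀ B :=
      PiecewiseContinuousOn.sum _ hB fun i _ => hpwb i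
    have hS0 : ∀ s, 0 ≤ ∑ i, (needleInterval τ α ε i).indicator (fun _ => K) s := fun s =>
      Finset.sum_nonneg fun i _ => indicator_nonneg (fun _ _ => hK0) s
    have key := hx₀.norm_sub_le hP hB hL hu₀ hu hx (κ := (∑ i, α i * K) * ε) (fun t ht => by
      refine (intervalIntegral.norm_integral_le_of_norm_le ht.1
        (g := fun s => ∑ i, (needleInterval τ α ε i).indicator (fun _ => K) s) ?_
        (hpwS.intervalIntegrable hlB ht)).trans ?_
      · refine Eventually.of_forall fun s hs => ?_
        rw [hudef, apply_needleControl_sub hd s fun w t => P.f (x₀ t) w t]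
        refine (norm_sum_le _ _).trans (Finset.sum_le_sum fun i _ => ?_)
        rw [norm_indicator_eq_indicator_norm]
        refine indicator_le_indicator' fun _ => hK i s ⟨hs.1.le, hs.2.trans ht.2⟩
      · refine (intervalIntegral.integral_mono_interval le_rfl ht.1 ht.2
          (Eventually.of_forall hS0) (hpwS.intervalIntegrable hlB ⟨hB, le_rfl⟩)).trans ?_
        rw [intervalIntegral.integral_finsetSum fun i _ =>
          (hpwb i).intervalIntegrable hlB ⟨hB, le_rfl⟩, Finset.sum_mul]
        refine Finset.sum_le_sum fun i _ => le_of_eq ?_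
        rw [needleInterval, intervalIntegral_indicator_Ico _ (hpos ε hε i).1 (hpos ε hε i).2
          (hend' i).le, intervalIntegral.integral_const, smul_eq_mul]
        ring)
    intro t ht
    exact (key t ht).trans (le_of_eq (by rw [hCdef]; ring))
  refine ⟨u, x, C, hTmem, huTe, ?_, hae, hC, ?_⟩
  · filter_upwards [hx, hTmem] with ε h1 h2
    exact h1.mono h2.2.le
  -- the needle part of the first variation
  have hu₀T : P.IsControl T u₀ := hPW.self_of_nhds
  have hx₀T := hx₀.mono hTB.le
  have ph : ∀ i, PiecewiseContinuousOn
      (fun t => M t (P.f (x₀ t) (v i) t - P.f (x₀ t) (u₀ t) t)) P.t₀ T := fun i =>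
    ((hM.piecewiseContinuousOn hT.le).prodMk
      (((isControl_const (hv i) hT.le).pwc_f hP hT.le hx₀T.1).sub hT.le
        (hu₀T.pwc_f hP hT.le hx₀T.1))).comp_continuous hT.le (φ := fun p => p.1 p.2)
      (isBoundedBilinearMap_apply.continuous)
  have hd : Tendsto (fun ε : ℝ => ε⁻¹ • ∫ t in P.t₀..T,
      M t (P.f (x₀ t) (u ε t) t - P.f (x₀ t) (u₀ t) t)) (𝓝[>] 0)
      (𝓝 (∑ i, α i • M (τ i) (P.f (x₀ (τ i)) (v i) (τ i) - P.f (x₀ (τ i)) (u₀ (τ i)) (τ i)))) := by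
    have h1 := tendsto_finsetSum Finset.univ fun i _ =>
      (ph i).tendsto_average_right (hτ i) (needleOffset_nonneg hα i) (hα i)
    refine h1.congr' ?_
    filter_upwards [hdisj, hend, self_mem_nhdsWithin] with ε hdj he (hε : 0 < ε)
    rw [← Finset.smul_sum]
    congr 1
    have h2 : ∀ t, M t (P.f (x₀ t) (u ε t) t - P.f (x₀ t) (u₀ t) t) =
        ∑ i, (needleInterval τ α ε i).indicator
          (fun t => M t (P.f (x₀ t) (v i) t - P.f (x₀ t) (u₀ t) t)) t := fun t => by
      simp only [map_sub]
      exact apply_needleControl_sub hdj t fun w t => M t (P.f (x₀ t) w t)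
    simp only [h2]
    have hpi : ∀ i, PiecewiseContinuousOn ((needleInterval τ α ε i).indicator
        (fun t => M t (P.f (x₀ t) (v i) t - P.f (x₀ t) (u₀ t) t))) P.t₀ T := fun i =>
      (ph i).indicator_Ico hT.le _ (he i).1
    rw [intervalIntegral.integral_finsetSum fun i _ => (hpi i).intervalIntegrable hlT hrT]
    refine Finset.sum_congr rfl fun i _ => ?_
    rw [needleInterval, intervalIntegral_indicator_Ico _ (hpos ε hε i).1 (hpos ε hε i).2 (he i).1.le]
  have hvar := tendsto_first_variation hP hT.le hu₀T hx₀T hM hMT hM' huT'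
    (hx.mono fun ε h => h.mono hTB.le) (C := C)
    (hC.mono fun ε h t ht => h t ⟨ht.1, ht.2.trans hTB.le⟩) hae hd
  -- the variation of the terminal time
  have hder : HasDerivAt x₀ (P.f (x₀ T) (u₀ T) T) T := by
    have hpf := hu₀.pwc_f hP hB hx₀.1
    have hct : ContinuousAt (fun t => P.f (x₀ t) (u₀ t) t) T := by
      have h1 : Tendsto (fun t => (x₀ t, u₀ t, t)) (𝓝 T) (𝓝[univ ×ˢ P.V ×ˢ Ici P.t₀]
          (x₀ T, u₀ T, T)) := by
        refine tendsto_nhdsWithin_iff.2 ⟨?_, ?_⟩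
        · exact (hx₀.1.continuousAt (Icc_mem_nhds hT hTB)).prodMk
            (huT.prodMk continuousAt_id)
        · filter_upwards [Icc_mem_nhds hT hTB] with t ht
          exact ⟨mem_univ _, hu₀.2 t ht, ht.1⟩
      exact (hP.continuous_f (x₀ T, u₀ T, T) ⟨mem_univ _, hu₀.2 T hTB', hT.le⟩).tendsto.comp h1
    have h1 := (intervalIntegral.integral_hasDerivAt_right (hpf.intervalIntegrable hlB hTB')
      ⟨Icc P.t₀ B, Icc_mem_nhds hT hTB, hpf.aestronglyMeasurable⟩ hct).const_add P.x₀
    refine h1.congr_of_eventuallyEq ?_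
    filter_upwards [Icc_mem_nhds hT hTB] with t ht
    exact hx₀.2 t ht
  have htime : Tendsto (fun ε : ℝ => ε⁻¹ • (x₀ (T + ε * β) - x₀ T)) (𝓝[>] 0)
      (𝓝 (β • P.f (x₀ T) (u₀ T) T)) := by
    have h1 : HasDerivAt (fun ε : ℝ => T + ε * β) β 0 := by
      simpa using ((hasDerivAt_id (0 : ℝ)).mul_const β).const_add T
    have h2 : HasDerivAt x₀ (P.f (x₀ T) (u₀ T) T) (T + 0 * β) := by simpa using hder
    have h3 := (h2.scomp 0 h1).hasDerivWithinAt (s := Ioi 0)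
    rw [hasDerivWithinAt_iff_tendsto_slope' (by simp)] at h3
    refine h3.congr fun ε => ?_
    simp [slope_def_module]
  -- Between `T` and `T + ε * β` the controls agree, because all needles end earlier. The velocities
  -- differ by `O(ε)` on a length `O(ε)`, so this mixed term is `O(ε²)`.
  have hrem : Tendsto (fun ε : ℝ => ε⁻¹ •
      ((x ε (T + ε * β) - x₀ (T + ε * β)) - (x ε T - x₀ T))) (𝓝[>] 0) (𝓝 0) := by
    have hbd : Tendsto (fun ε : ℝ => L * C * |β| * ε) (𝓝[>] 0) (𝓝 0) := by
      have : Tendsto (fun ε : ℝ => L * C * |β| * ε) (𝓝[>] 0) (𝓝 (L * C * |β| * 0)) :=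
        (Continuous.tendsto (by fun_prop) 0).mono_left nhdsWithin_le_nhds
      simpa using this
    refine squeeze_zero_norm' ?_ hbd
    filter_upwards [hend, huB, hx, hC, hTmem, self_mem_nhdsWithin] with ε he hu hx hC hTm
      (hε : 0 < ε)
    have hTm' : T + ε * β ∈ Icc P.t₀ B := ⟨hTm.1.le, hTm.2.le⟩
    have p1 := hu.pwc_f hP hB hx.1
    have p0 := hu₀.pwc_f hP hB hx₀.1
    have hI : (x ε (T + ε * β) - x₀ (T + ε * β)) - (x ε T - x₀ T) =
        ∫ s in T..(T + ε * β), (P.f (x ε s) (u ε s) s - P.f (x₀ s) (u₀ s) s) := by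
      rw [intervalIntegral.integral_sub (p1.intervalIntegrable hTB' hTm')
        (p0.intervalIntegrable hTB' hTm'),
        ← intervalIntegral.integral_interval_sub_left (p1.intervalIntegrable hlB hTm')
          (p1.intervalIntegrable hlB hTB'),
        ← intervalIntegral.integral_interval_sub_left (p0.intervalIntegrable hlB hTm')
          (p0.intervalIntegrable hlB hTB'), hx.2 _ hTm', hx.2 _ hTB', hx₀.2 _ hTm', hx₀.2 _ hTB']
      abel
    rw [hI, norm_smul, norm_inv, Real.norm_eq_abs, abs_of_pos hε, inv_mul_le_iff₀ hε]
    have hb := intervalIntegral.norm_integral_le_of_norm_le_const (a := T) (b := T + ε * β)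
      (f := fun s => P.f (x ε s) (u ε s) s - P.f (x₀ s) (u₀ s) s) (C := L * (C * ε))
      (fun s hs => by
        have hs' : s ∈ Icc P.t₀ B := uIcc_subset_Icc hTB' hTm' (uIoc_subset_uIcc hs)
        have hmin : min T (T + ε * β) < s := hs.1
        have hus : u ε s = u₀ s := needleControl_of_forall_notMem fun i hi => by
          have := lt_min (he i).1 (he i).2
          linarith [hi.2]
        rw [hus, ← dist_eq_norm]
        refine ((hL _ (hu₀.2 s hs') s hs').dist_le_mul _ _).trans ?_
        rw [dist_eq_norm]
        gcongr
        exact hC s hs')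
    refine hb.trans (le_of_eq ?_)
    rw [add_sub_cancel_left, abs_mul, abs_of_pos hε]
    ring
  have hfin := (hvar.add htime).add hrem
  rw [add_zero] at hfin
  refine hfin.congr fun ε => ?_
  rw [← smul_add, ← smul_add]
  congr 1
  abel

end MayerProblem

/-! ### Convergence in `rho` and the penalty function -/

/-- `L²` convergence of piecewise continuous functions on varying intervals, extended by zero. -/
theorem tendsto_sqrt_integral_indicator_sub {F : Type*} [NormedAddCommGroup F] {a T C : ℝ}
    {l : Filter ℝ} [l.IsCountablyGenerated] {S : ℝ → ℝ} (hS : Tendsto S l (𝓝 T))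
    {w : ℝ → ℝ → F} {w₀ : ℝ → F} (hw : ∀ᶠ ε in l, PiecewiseContinuousOn (w ε) a (S ε))
    (hw₀ : PiecewiseContinuousOn w₀ a T) (hC : ∀ᶠ ε in l, ∀ t ∈ Icc a (S ε), ‖w ε t‖ ≤ C)
    (hlim : ∀ᵐ t : ℝ, t ∈ Ico a T → Tendsto (fun ε => w ε t) l (𝓝 (w₀ t))) :
    Tendsto (fun ε => √(∫ t, ‖(Icc a (S ε)).indicator (w ε) t - (Icc a T).indicator w₀ t‖ ^ 2)) l
      (𝓝 0) := by
  obtain ⟨C₀, hC₀⟩ := hw₀.exists_norm_le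
  set D : ℝ := |C| + |C₀| with hD
  have hmain : Tendsto
      (fun ε => ∫ t, ‖(Icc a (S ε)).indicator (w ε) t - (Icc a T).indicator w₀ t‖ ^ 2) l
      (𝓝 (∫ _ : ℝ, (0 : ℝ))) := by
    refine tendsto_integral_filter_of_dominated_convergence
      ((Icc a (T + 1)).indicator fun _ => D ^ 2) ?_ ?_ ?_ ?_
    · filter_upwards [hw] with ε hw
      have h1 := (aestronglyMeasurable_indicator_iff measurableSet_Icc).2 hw.aestronglyMeasurable
      have h2 := (aestronglyMeasurable_indicator_iff measurableSet_Icc).2 hw₀.aestronglyMeasurable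
      exact ((h1.sub h2).norm).pow 2
    · filter_upwards [hC, hS.eventually_lt_const (lt_add_one T)] with ε hC hSε
      refine Eventually.of_forall fun t => ?_
      rw [Real.norm_eq_abs, abs_of_nonneg (by positivity)]
      by_cases ht : t ∈ Icc a (T + 1)
      · rw [indicator_of_mem ht]
        have h1 : ‖(Icc a (S ε)).indicator (w ε) t‖ ≤ |C| := by
          by_cases h : t ∈ Icc a (S ε)
          · rw [indicator_of_mem h]; exact (hC t h).trans (le_abs_self _)
          · rw [indicator_of_notMem h]; simp
        have h2 : ‖(Icc a T).indicator w₀ t‖ ≤ |C₀| := by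
          by_cases h : t ∈ Icc a T
          · rw [indicator_of_mem h]; exact (hC₀ t h).trans (le_abs_self _)
          · rw [indicator_of_notMem h]; simp
        gcongr
        exact (norm_sub_le _ _).trans (add_le_add h1 h2)
      · rw [indicator_of_notMem ht, indicator_of_notMem fun h => ht ⟨h.1, h.2.trans hSε.le⟩,
          indicator_of_notMem fun h => ht ⟨h.1, by linarith [h.2]⟩]
        simp
    · exact (integrable_indicator_iff measurableSet_Icc).2 (integrableOn_const (by simp))
    · have hT : ∀ᵐ t : ℝ, t ≠ T := by simp [ae_iff]
      filter_upwards [hlim, hT] with t hlim hT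
      rcases lt_or_ge t a with hta | hta
      · refine tendsto_const_nhds.congr fun ε => ?_
        rw [indicator_of_notMem fun h => hta.not_ge h.1,
          indicator_of_notMem fun h => hta.not_ge h.1]
        simp
      rcases lt_or_gt_of_ne hT with h | h
      · have h1 : Tendsto (fun ε => ‖w ε t - w₀ t‖ ^ 2) l (𝓝 (‖w₀ t - w₀ t‖ ^ 2)) :=
          (((hlim ⟨hta, h⟩).sub_const _).norm).pow 2
        rw [sub_self, norm_zero, zero_pow two_ne_zero] at h1
        refine h1.congr' ?_
        filter_upwards [hS.eventually_const_lt h] with ε hε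
        rw [indicator_of_mem (show t ∈ Icc a (S ε) from ⟨hta, hε.le⟩),
          indicator_of_mem (show t ∈ Icc a T from ⟨hta, h.le⟩)]
      · refine tendsto_const_nhds.congr' ?_
        filter_upwards [hS.eventually_lt_const h] with ε hε
        rw [indicator_of_notMem fun h' => hε.not_ge h'.2,
          indicator_of_notMem fun h' => h.not_ge h'.2]
        simp
  simpa using hmain.sqrt

namespace MayerProblem

variable {n m : ℕ} {E I : Type*} {P : MayerProblem n m E I}

/-- Exactness makes the optimal triple a minimiser of the penalty function. -/
theorem IsExactPenaltyConstant.cost_le {ξ : Triple n m} {N : Set (Triple n m)} {c : ℝ}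
    (hexact : P.IsExactPenaltyConstant N c) (hopt : P.IsOptimalIn N ξ) {η : Triple n m}
    (hη : η ∈ N) : P.cost ξ ≤ P.penalized c η := by
  have h1 : ((P.cost ξ : ℝ) : EReal) ≤ ⨅ ζ ∈ N ∩ P.admissible, ((P.cost ζ : ℝ) : EReal) :=
    le_iInf₂ fun ζ hζ => EReal.coe_le_coe_iff.2 (hopt.2 ζ hζ)
  rw [← hexact.2] at h1
  exact EReal.coe_le_coe_iff.1 (h1.trans (iInf₂_le η hη))

/-- The triple of a control and its trajectory. -/
def trajectoryTriple (P : MayerProblem n m E I) (T : ℝ) (u : ℝ → EuclideanSpace ℝ (Fin m))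
    (x : ℝ → EuclideanSpace ℝ (Fin n)) : Triple n m where
  z t := P.f (x t) (u t) t
  u := u
  T := T

theorem IsTrajectory.state_eq {T : ℝ} {u : ℝ → EuclideanSpace ℝ (Fin m)}
    {x : ℝ → EuclideanSpace ℝ (Fin n)} (hx : P.IsTrajectory T u x) {t : ℝ}
    (ht : t ∈ Icc P.t₀ T) : P.state (P.trajectoryTriple T u x) t = x t :=
  (hx.2 t ht).symm

theorem IsControl.trajectoryTriple_mem_space (hP : P.Standing) {T : ℝ} (hT : P.t₀ < T)
    {u : ℝ → EuclideanSpace ℝ (Fin m)} (hu : P.IsControl T u)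
    {x : ℝ → EuclideanSpace ℝ (Fin n)} (hx : P.IsTrajectory T u x) :
    P.trajectoryTriple T u x ∈ P.space :=
  ⟨hT, hu.pwc_f hP hT.le hx.1, hu.1, hu.2⟩

theorem IsTrajectory.penaltyDiff_eq_zero {T : ℝ} (hT : P.t₀ ≤ T)
    {u : ℝ → EuclideanSpace ℝ (Fin m)} {x : ℝ → EuclideanSpace ℝ (Fin n)}
    (hx : P.IsTrajectory T u x) : P.penaltyDiff (P.trajectoryTriple T u x) = 0 := by
  have h : ∫ t in P.t₀..(P.trajectoryTriple T u x).T, ‖(P.trajectoryTriple T u x).z t -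
      P.f (P.state (P.trajectoryTriple T u x) t) ((P.trajectoryTriple T u x).u t) t‖ ^ 2 =
      ∫ _ in P.t₀..(P.trajectoryTriple T u x).T, (0 : ℝ) := by
    refine intervalIntegral.integral_congr fun t ht => ?_
    have ht' : t ∈ Icc P.t₀ T := by rwa [← uIcc_of_le hT]
    simp only [hx.state_eq ht']
    simp [trajectoryTriple]
  rw [penaltyDiff, h]
  simp

/-- The condition `0 ≤ r` also covers an empty index type, where the real supremum is `0`. -/
theorem penaltyTerm_le {ξ : Triple n m} {r : ℝ} (hr : 0 ≤ r)
    (hE : ∀ k, |P.ΦE k (P.state ξ ξ.T)| ≤ r) (hI : ∀ j, P.ΦI j (P.state ξ ξ.T) ≤ r) :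
    P.penaltyTerm ξ ≤ r :=
  max_le (Real.iSup_le hE hr) (Real.iSup_le (fun j => max_le hr (hI j)) hr)

/-- Along a curve of end points with initial velocity `d`, the first-order change of the exact
penalty function is nonnegative if the curve stays where the penalty function is minimal. -/
theorem nonneg_of_tendsto_endpoint [Finite E] [Finite I] (hP : P.Standing)
    {x₀ d : EuclideanSpace ℝ (Fin n)} (hE : ∀ k, P.ΦE k x₀ = 0) (hI : ∀ j, P.ΦI j x₀ ≤ 0)
    {c : ℝ} (hc : 0 ≤ c) {η : ℝ → Triple n m}
    (hd : Tendsto (fun ε : ℝ => ε⁻¹ • (P.state (η ε) (η ε).T - x₀)) (𝓝[>] 0) (𝓝 d))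
    (hmin : ∀ᶠ ε in 𝓝[>] (0 : ℝ), P.Φ₀ x₀ ≤ P.cost (η ε) + c * P.penaltyTerm (η ε))
    {s : ℝ} (hs : 0 ≤ s) (hsE : ∀ k, |inner ℝ (gradient (P.ΦE k) x₀) d| ≤ s)
    (hsI : ∀ j, P.ΦI j x₀ = 0 → inner ℝ (gradient (P.ΦI j) x₀) d ≤ s) :
    0 ≤ inner ℝ (gradient P.Φ₀ x₀) d + c * s := by
  set y : ℝ → EuclideanSpace ℝ (Fin n) := fun ε => P.state (η ε) (η ε).T with hy
  have hid : Tendsto (fun ε : ℝ => ε) (𝓝[>] 0) (𝓝 0) := nhdsWithin_le_nhds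
  have hd0 : Tendsto (fun ε => y ε - x₀) (𝓝[>] 0) (𝓝 0) := by
    have := hid.smul hd
    rw [zero_smul] at this
    refine this.congr' ?_
    filter_upwards [self_mem_nhdsWithin] with ε (hε : 0 < ε)
    rw [smul_inv_smul₀ hε.ne']
  have hy0 : Tendsto y (𝓝[>] 0) (𝓝 x₀) := by simpa using hd0.add_const x₀
  have hder : ∀ φ : EuclideanSpace ℝ (Fin n) → ℝ, ContDiff ℝ 1 φ →
      Tendsto (fun ε : ℝ => ε⁻¹ * (φ (y ε) - φ x₀)) (𝓝[>] 0) (𝓝 (inner ℝ (gradient φ x₀) d)) := by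
    intro φ hφ
    have h := ((hφ.differentiable one_ne_zero x₀).hasFDerivAt.hasFDerivWithinAt (s := univ)).lim
      hd0 (by simp) hd
    simpa [inner_gradient_left] using h
  -- The slack `δ` turns limits of difference quotients into inequalities at one small `ε`; inactive
  -- constraints stay negative by continuity.
  have key : ∀ δ > 0, 0 ≤ inner ℝ (gradient P.Φ₀ x₀) d + δ + c * (s + δ) := by
    intro δ hδ
    have e0 := (hder _ hP.smooth_cost).eventually_lt_const (lt_add_of_pos_right _ hδ)
    have eE : ∀ᶠ ε in 𝓝[>] (0 : ℝ), ∀ k, |P.ΦE k (y ε)| ≤ ε * (s + δ) := by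
      refine eventually_all.2 fun k => ?_
      have h1 := (hder _ (hP.smooth_eq k)).abs.eventually_lt_const
        (lt_of_le_of_lt (hsE k) (lt_add_of_pos_right _ hδ))
      filter_upwards [h1, self_mem_nhdsWithin] with ε h1 (hε : 0 < ε)
      rw [hE k, sub_zero, abs_mul, abs_inv, abs_of_pos hε, inv_mul_lt_iff₀ hε] at h1
      exact h1.le
    have eI : ∀ᶠ ε in 𝓝[>] (0 : ℝ), ∀ j, P.ΦI j (y ε) ≤ ε * (s + δ) := by
      refine eventually_all.2 fun j => ?_
      rcases (hI j).lt_or_eq with h | h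
      · have h1 : Tendsto (fun ε => P.ΦI j (y ε)) (𝓝[>] 0) (𝓝 (P.ΦI j x₀)) :=
          ((hP.smooth_ineq j).continuous.tendsto x₀).comp hy0
        filter_upwards [h1.eventually_lt_const h, self_mem_nhdsWithin] with ε h1 (hε : 0 < ε)
        exact h1.le.trans (by positivity)
      · have h1 := (hder _ (hP.smooth_ineq j)).eventually_lt_const
          (lt_of_le_of_lt (hsI j h) (lt_add_of_pos_right _ hδ))
        filter_upwards [h1, self_mem_nhdsWithin] with ε h1 (hε : 0 < ε)
        rw [h, sub_zero, inv_mul_lt_iff₀ hε] at h1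
        exact h1.le
    obtain ⟨ε, h0, hE', hI', hm, hε⟩ :=
      (e0.and (eE.and (eI.and (hmin.and self_mem_nhdsWithin)))).exists
    have hε : 0 < ε := hε
    have hpen : P.penaltyTerm (η ε) ≤ ε * (s + δ) :=
      penaltyTerm_le (by positivity) hE' hI'
    rw [inv_mul_lt_iff₀ hε] at h0
    have hcost : P.cost (η ε) = P.Φ₀ (y ε) := rfl
    have h2 : 0 ≤ ε * (inner ℝ (gradient P.Φ₀ x₀) d + δ + c * (s + δ)) := by
      have := mul_le_mul_of_nonneg_left hpen hc
      rw [hcost] at hm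
      linarith
    exact nonneg_of_mul_nonneg_right h2 hε
  have hl : Tendsto (fun δ : ℝ => inner ℝ (gradient P.Φ₀ x₀) d + δ + c * (s + δ)) (𝓝[>] 0)
      (𝓝 (inner ℝ (gradient P.Φ₀ x₀) d + 0 + c * (s + 0))) :=
    (Continuous.tendsto (by fun_prop) 0).mono_left nhdsWithin_le_nhds
  simpa using ge_of_tendsto hl (eventually_nhdsWithin_of_forall key)

/-- The reference control extended beyond `T` by its end value, with its trajectory. -/
theorem exists_extension (hP : P.Standing) {ξ : Triple n m} (hξ : ξ ∈ P.admissible) :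
    ∃ (u₀ : ℝ → EuclideanSpace ℝ (Fin m)) (x₀ : ℝ → EuclideanSpace ℝ (Fin n)),
      P.IsControl (ξ.T + 1) u₀ ∧ ContinuousAt u₀ ξ.T ∧ P.IsTrajectory (ξ.T + 1) u₀ x₀ ∧
      (∀ t ∈ Icc P.t₀ ξ.T, u₀ t = ξ.u t) ∧ ∀ t ∈ Icc P.t₀ ξ.T, x₀ t = P.state ξ t := by
  obtain ⟨⟨hT, hz, hu, hV⟩, hode, -⟩ := hξ
  set u₀ : ℝ → EuclideanSpace ℝ (Fin m) := fun t => ξ.u (min t ξ.T) with hu₀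
  have hmin : Continuous fun t : ℝ => min t ξ.T := by fun_prop
  have hc : P.IsControl (ξ.T + 1) u₀ :=
    ⟨hu.comp_min hT.le (by linarith), fun t ht => hV _ ⟨le_min ht.1 hT.le, min_le_right _ _⟩⟩
  obtain ⟨x₀, hx₀⟩ := hc.exists_trajectory hP (by linarith)
  have heq : ∀ t ∈ Icc P.t₀ ξ.T, u₀ t = ξ.u t := fun t ht => by
    simp only [hu₀, min_eq_left ht.2]
  refine ⟨u₀, x₀, hc, ?_, hx₀, heq, ?_⟩
  · have h1 : Tendsto (fun t : ℝ => min t ξ.T) (𝓝 ξ.T) (𝓝[Icc P.t₀ ξ.T] ξ.T) := by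
      refine tendsto_nhdsWithin_iff.2 ⟨by simpa using hmin.tendsto ξ.T, ?_⟩
      filter_upwards [Ioi_mem_nhds hT] with t ht
      exact ⟨le_min (le_of_lt ht) hT.le, min_le_right _ _⟩
    have h2 : Tendsto u₀ (𝓝 ξ.T) (𝓝 (ξ.u ξ.T)) := hu.2.2.2.tendsto.comp h1
    simpa [ContinuousAt, hu₀] using h2
  · obtain ⟨L, hL⟩ := hP.lipschitz_f ξ.T
    have hcT : P.IsControl ξ.T u₀ := ⟨hu.congr hT.le heq, fun t ht => by
      rw [heq t ht]; exact hV t ht⟩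
    have hst : P.IsTrajectory ξ.T u₀ (P.state ξ) := by
      refine ⟨continuousOn_const.add (hz.continuousOn_integral hT.le), fun t ht => ?_⟩
      rw [state]
      congr 1
      refine intervalIntegral.integral_congr fun s hs => ?_
      rw [uIcc_of_le ht.1] at hs
      have hs' : s ∈ Icc P.t₀ ξ.T := ⟨hs.1, hs.2.trans ht.2⟩
      simp only [heq s hs']
      exact hode s hs'
    -- Uniqueness of trajectories: continuous dependence with equal controls.
    have := hst.norm_sub_le hP hT.le hL hcT hcT (hx₀.mono (by linarith)) (κ := 0) (by simp)
    intro t ht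
    have h := this t ht
    rw [zero_mul] at h
    exact sub_eq_zero.1 (norm_le_zero_iff.1 h)

end MayerProblem

/-! ### The first-order condition on the variation cone -/

namespace MayerProblem

variable {n m : ℕ} {E I : Type*} {P : MayerProblem n m E I}

/-- Triples of trajectories converge if the controls converge almost everywhere and the states
converge uniformly. -/
theorem tendsto_rho_trajectoryTriple (hP : P.Standing) {ξ : Triple n m} (hξ : ξ ∈ P.admissible)
    {u₀ : ℝ → EuclideanSpace ℝ (Fin m)} {x₀ : ℝ → EuclideanSpace ℝ (Fin n)} {B : ℝ}
    (hTB : ξ.T ≤ B) (hx₀ : ContinuousOn x₀ (Icc P.t₀ B))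
    (hu₀ξ : ∀ t ∈ Icc P.t₀ ξ.T, u₀ t = ξ.u t) (hx₀ξ : ∀ t ∈ Icc P.t₀ ξ.T, x₀ t = P.state ξ t)
    {S : ℝ → ℝ} (hS : Tendsto S (𝓝[>] 0) (𝓝 ξ.T)) {u : ℝ → ℝ → EuclideanSpace ℝ (Fin m)}
    {x : ℝ → ℝ → EuclideanSpace ℝ (Fin n)} (hSB : ∀ᶠ ε in 𝓝[>] (0 : ℝ), S ε ∈ Ioo P.t₀ B)
    (hu : ∀ᶠ ε in 𝓝[>] 0, P.IsControl (S ε) (u ε))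
    (hx : ∀ᶠ ε in 𝓝[>] 0, P.IsTrajectory (S ε) (u ε) (x ε))
    (hae : ∀ᵐ t : ℝ, ∀ᶠ ε in 𝓝[>] 0, u ε t = u₀ t) {C : ℝ}
    (hC : ∀ᶠ ε in 𝓝[>] (0 : ℝ), ∀ t ∈ Icc P.t₀ B, ‖x ε t - x₀ t‖ ≤ C * ε) :
    Tendsto (fun ε => P.rho (P.trajectoryTriple (S ε) (u ε) (x ε)) ξ) (𝓝[>] 0) (𝓝 0) := by
  obtain ⟨⟨hT, hz, huξ, hV⟩, hode, -⟩ := hξ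
  have hCε : Tendsto (fun ε : ℝ => C * ε) (𝓝[>] 0) (𝓝 0) := by
    have : Tendsto (fun ε : ℝ => C * ε) (𝓝[>] 0) (𝓝 (C * 0)) :=
      (Continuous.tendsto (by fun_prop) 0).mono_left nhdsWithin_le_nhds
    simpa using this
  obtain ⟨Ru, hRu⟩ := hP.compact_V.exists_bound_of_continuousOn continuousOn_id
  obtain ⟨R, hR⟩ := isCompact_Icc.exists_bound_of_continuousOn hx₀
  -- For small `ε` the states stay within distance 1 of `x₀`, hence in this ball; compactness bounds
  -- the velocities uniformly and supplies the domination.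
  obtain ⟨Rz, hRz⟩ := ((isCompact_closedBall (0 : EuclideanSpace ℝ (Fin n)) (R + 1)).prod
    (hP.compact_V.prod (isCompact_Icc (a := P.t₀) (b := B)))).exists_bound_of_continuousOn
    (hP.continuous_f.mono fun p hp => ⟨mem_univ _, hp.2.1, hp.2.2.1⟩)
  have h1 := tendsto_sqrt_integral_indicator_sub (a := P.t₀) (C := Rz) hS
    (w := fun ε t => P.f (x ε t) (u ε t) t) (w₀ := ξ.z) (by
      filter_upwards [hu, hx, hSB] with ε hu hx hSB
      exact hu.pwc_f hP hSB.1.le hx.1) hz (by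
      filter_upwards [hu, hC, hSB, hCε.eventually_lt_const one_pos] with ε hu hC hSB h1 t ht
      have ht' : t ∈ Icc P.t₀ B := ⟨ht.1, ht.2.trans hSB.2.le⟩
      refine hRz (x ε t, u ε t, t) ⟨?_, hu.2 t ht, ht'⟩
      rw [mem_closedBall_zero_iff]
      have h2 := norm_add_le (x ε t - x₀ t) (x₀ t)
      rw [sub_add_cancel] at h2
      linarith [hC t ht', hR t ht']) (by
      filter_upwards [hae] with t hae ht
      have ht' : t ∈ Icc P.t₀ ξ.T := ⟨ht.1, ht.2.le⟩
      have hlim : Tendsto (fun ε => x ε t) (𝓝[>] 0) (𝓝 (x₀ t)) := by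
        refine tendsto_iff_norm_sub_tendsto_zero.2 (squeeze_zero' (Eventually.of_forall fun _ =>
          norm_nonneg _) (hC.mono fun ε h => h t ⟨ht.1, ht.2.le.trans hTB⟩) hCε)
      rw [hode t ht', ← hu₀ξ t ht', ← hx₀ξ t ht']
      have hc : ContinuousAt (fun y => P.f y (u₀ t) t) (x₀ t) :=
        (hP.differentiable_f _ _ (by rw [hu₀ξ t ht']; exact hV t ht') t ht.1).continuousAt
      refine (hc.tendsto.comp hlim).congr' ?_
      filter_upwards [hae] with ε h
      simp [h])
  have h2 := tendsto_sqrt_integral_indicator_sub (a := P.t₀) (C := Ru) hS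
    (w := u) (w₀ := ξ.u) (hu.mono fun ε h => h.1) huξ
    (hu.mono fun ε h t ht => hRu _ (h.2 t ht)) (by
      filter_upwards [hae] with t hae ht
      rw [← hu₀ξ t ⟨ht.1, ht.2.le⟩]
      exact tendsto_const_nhds.congr' (hae.mono fun ε h => h.symm))
  have h3 : Tendsto (fun ε => |S ε - ξ.T|) (𝓝[>] 0) (𝓝 0) := by
    simpa using (hS.sub_const ξ.T).abs
  have h := (h1.add h2).add h3
  rw [add_zero, add_zero] at h
  exact h

/-- First-order necessary condition along the cone of needle and terminal-time variations. -/
theorem nonneg_on_variation [Finite E] [Finite I] (hP : P.Standing) {ξ : Triple n m}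
    {N : Set (Triple n m)} (hN : P.IsNhd N ξ) (hopt : P.IsOptimalIn N ξ) {c : ℝ}
    (hexact : P.IsExactPenaltyConstant N c)
    {M : ℝ → EuclideanSpace ℝ (Fin n) →L[ℝ] EuclideanSpace ℝ (Fin n)}
    (hM : ContinuousOn M (Icc P.t₀ ξ.T)) (hMT : M ξ.T = 1)
    (hM' : ∀ t ∈ Ico P.t₀ ξ.T,
      HasDerivWithinAt M (-(M t * P.fx (P.state ξ t) (ξ.u t) t)) (Ici t) t)
    {k : ℕ} {τ α : Fin k → ℝ} {v : Fin k → EuclideanSpace ℝ (Fin m)}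
    (hτ : ∀ i, τ i ∈ Ico P.t₀ ξ.T) (hα : ∀ i, 0 ≤ α i) (hv : ∀ i, v i ∈ P.V) (β : ℝ)
    {d : EuclideanSpace ℝ (Fin n)}
    (hd : d = (∑ i, α i • M (τ i) (P.f (P.state ξ (τ i)) (v i) (τ i) -
      P.f (P.state ξ (τ i)) (ξ.u (τ i)) (τ i))) + β • P.f (P.state ξ ξ.T) (ξ.u ξ.T) ξ.T)
    {s : ℝ} (hs : 0 ≤ s) (hsE : ∀ k, |inner ℝ (gradient (P.ΦE k) (P.state ξ ξ.T)) d| ≤ s)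
    (hsI : ∀ j, P.ΦI j (P.state ξ ξ.T) = 0 →
      inner ℝ (gradient (P.ΦI j) (P.state ξ ξ.T)) d ≤ s) :
    0 ≤ inner ℝ (gradient P.Φ₀ (P.state ξ ξ.T)) d + c * s := by
  have hξ := hopt.1
  have hT : P.t₀ < ξ.T := hξ.1.1
  obtain ⟨u₀, x₀, hu₀, huT, hx₀, hu₀ξ, hx₀ξ⟩ := exists_extension hP hξ
  have hr : ξ.T ∈ Icc P.t₀ ξ.T := ⟨hT.le, le_rfl⟩
  obtain ⟨u, x, C, hS, hu, hx, hae, hC, hlim⟩ := exists_needle_variation hP hT (lt_add_one ξ.T)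
    hu₀ huT hx₀ hM hMT (fun t ht => by
      rw [hx₀ξ t ⟨ht.1, ht.2.le⟩, hu₀ξ t ⟨ht.1, ht.2.le⟩]; exact hM' t ht) hτ hα hv β
  have hτ' : ∀ i, τ i ∈ Icc P.t₀ ξ.T := fun i => ⟨(hτ i).1, (hτ i).2.le⟩
  simp only [hx₀ξ _ (hτ' _), hu₀ξ _ (hτ' _), hx₀ξ _ hr, hu₀ξ _ hr] at hlim
  rw [← hd] at hlim
  have hSlim : Tendsto (fun ε : ℝ => ξ.T + ε * β) (𝓝[>] 0) (𝓝 ξ.T) := by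
    have : Tendsto (fun ε : ℝ => ξ.T + ε * β) (𝓝[>] 0) (𝓝 (ξ.T + 0 * β)) :=
      (Continuous.tendsto (by fun_prop) 0).mono_left nhdsWithin_le_nhds
    simpa using this
  have hrho := tendsto_rho_trajectoryTriple hP hξ (lt_add_one ξ.T).le hx₀.1 hu₀ξ hx₀ξ hSlim hS hu
    hx hae hC
  obtain ⟨r, hr0, hrN⟩ := hN.2
  refine nonneg_of_tendsto_endpoint hP hξ.2.2.1 hξ.2.2.2 hexact.1
    (η := fun ε => P.trajectoryTriple (ξ.T + ε * β) (u ε) (x ε)) ?_ ?_ hs hsE hsI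
  · refine hlim.congr' ?_
    filter_upwards [hx, hS] with ε hx hS
    have : P.state (P.trajectoryTriple (ξ.T + ε * β) (u ε) (x ε)) (ξ.T + ε * β) =
        x ε (ξ.T + ε * β) := hx.state_eq ⟨hS.1.le, le_rfl⟩
    rw [← this]
    rfl
  · filter_upwards [hu, hx, hS, hrho.eventually_lt_const hr0] with ε hu hx hS hrho
    have hmem := hrN _ (hu.trajectoryTriple_mem_space hP hS.1 hx) hrho
    have h := hexact.cost_le hopt hmem
    rwa [penalized, hx.penaltyDiff_eq_zero hS.1.le, zero_add] at h

end MayerProblem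

end

/-! ### The maximum principle -/

theorem mainTheorem2 {n m : ℕ} {E I : Type*} [Fintype E] [Fintype I]
    (P : MayerProblem n m E I) (hP : P.Standing)
    (ξ : Triple n m) (N : Set (Triple n m)) (hN : P.IsNhd N ξ) (hopt : P.IsOptimalIn N ξ)
    (c : ℝ) (hexact : P.IsExactPenaltyConstant N c) :
    ∃ (ψ : ℝ → EuclideanSpace ℝ (Fin n)) (ν : E → ℝ) (μ : I → ℝ),
      -- adjoint equation
      P.IsAdjoint ξ ψ ∧
      -- maximum principle
      (∀ t ∈ Icc P.t₀ ξ.T, ∀ v ∈ P.V,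
        P.hamiltonian (P.state ξ t) v (ψ t) t ≤ P.hamiltonian (P.state ξ t) (ξ.u t) (ψ t) t) ∧
      -- its stationary form, wherever it makes sense
      (∀ t ∈ Icc P.t₀ ξ.T, ξ.u t ∈ interior P.V →
        DifferentiableAt ℝ (fun v => P.f (P.state ξ t) v t) (ξ.u t) →
        (ContinuousLinearMap.adjoint (P.fu (P.state ξ t) (ξ.u t) t)) (ψ t) = 0) ∧
      -- multipliers
      (∀ j, 0 ≤ μ j) ∧ (∀ j, μ j * P.ΦI j (P.state ξ ξ.T) = 0) ∧
      -- transversality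
      ψ ξ.T = -gradient P.Φ₀ (P.state ξ ξ.T)
        - ∑ k, ν k • gradient (P.ΦE k) (P.state ξ ξ.T)
        - ∑ j, μ j • gradient (P.ΦI j) (P.state ξ ξ.T) ∧
      -- the Hamiltonian vanishes at the terminal time
      P.hamiltonian (P.state ξ ξ.T) (ξ.u ξ.T) (ψ ξ.T) ξ.T = 0 := by
  classical
  obtain ⟨hT, hz, hu, hV⟩ := hopt.1.1
  have hcu : P.IsControl ξ.T ξ.u := ⟨hu, hV⟩
  have hr : ξ.T ∈ Icc P.t₀ ξ.T := ⟨hT.le, le_rfl⟩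
  have hst : ContinuousOn (P.state ξ) (Icc P.t₀ ξ.T) :=
    continuousOn_const.add (hz.continuousOn_integral hT.le)
  obtain ⟨M, hM, hMT, hM'⟩ := exists_backward_linear_solution hT.le (hcu.pwc_fx hP hT.le hst)
  set xT := P.state ξ ξ.T with hxT
  set fT := P.f xT (ξ.u ξ.T) ξ.T with hfT
  let S : Set (EuclideanSpace ℝ (Fin n)) := {d | ∃ t ∈ Ico P.t₀ ξ.T, ∃ v ∈ P.V,
    d = M t (P.f (P.state ξ t) v t - P.f (P.state ξ t) (ξ.u t) t)}
  -- Spans are over nonnegative scalars. The pair `fT`, `-fT` generates a line, since the terminal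
  -- time may move both ways.
  let K : PointedCone ℝ (EuclideanSpace ℝ (Fin n)) :=
    Submodule.span _ S ⊔ Submodule.span _ {fT, -fT}
  -- Both signs of each equality gradient encode its absolute value; the zero vector removes
  -- inactive inequalities.
  let a : E ⊕ E ⊕ I → EuclideanSpace ℝ (Fin n) := Sum.elim (fun k => gradient (P.ΦE k) xT)
    (Sum.elim (fun k => -gradient (P.ΦE k) xT)
      fun j => if P.ΦI j xT = 0 then gradient (P.ΦI j) xT else 0)
  obtain ⟨l, hl0, hl⟩ := exists_multipliers_of_forall_mem_cone K (gradient P.Φ₀ xT) a hexact.1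
    (fun d hd s hs hsa => by
      obtain ⟨d₁, hd₁, d₂, hd₂, rfl⟩ := Submodule.mem_sup.1 hd
      obtain ⟨k, α, g, rfl⟩ := Submodule.mem_span_set'.1 hd₁
      obtain ⟨p, q, rfl⟩ := Submodule.mem_span_pair.1 hd₂
      choose τ hτ v hv hg using fun i => (g i).2
      refine MayerProblem.nonneg_on_variation hP hN hopt hexact hM hMT hM' hτ (α := fun i => (α i : ℝ))
        (fun i => (α i).2) hv ((p : ℝ) - q) ?_ hs (fun k => abs_le.2 ⟨?_, hsa (Sum.inl k)⟩)
        fun j hj => ?_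
      · congr 1
        · exact Finset.sum_congr rfl fun i _ => by rw [← hg i]; rfl
        · rw [sub_smul, smul_neg, ← sub_eq_add_neg]
          rfl
      · have := hsa (Sum.inr (Sum.inl k))
        simp only [a, Sum.elim_inr, Sum.elim_inl, inner_neg_left] at this
        linarith
      · have := hsa (Sum.inr (Sum.inr j))
        simpa only [a, Sum.elim_inr, hxT.symm ▸ hj, if_true] using this)
  set p := gradient P.Φ₀ xT + ∑ i, l i • a i with hp
  -- The map `A ↦ -Aᵀ p` is continuous and linear, so `ψ = Ad ∘ M` inherits continuity and its right
  -- derivative from `M`.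
  let Ad : (EuclideanSpace ℝ (Fin n) →L[ℝ] EuclideanSpace ℝ (Fin n)) →L[ℝ]
      EuclideanSpace ℝ (Fin n) :=
    AddMonoidHom.toRealLinearMap
      ⟨⟨fun A => -(ContinuousLinearMap.adjoint A) p, by simp⟩, fun A B => by
        simp only [map_add, add_apply, neg_add]⟩
      (by
        have : Continuous fun A : EuclideanSpace ℝ (Fin n) →L[ℝ] EuclideanSpace ℝ (Fin n) =>
          -(ContinuousLinearMap.adjoint A) p := by fun_prop
        exact this)
  have hAd : ∀ A, Ad A = -(ContinuousLinearMap.adjoint A) p := fun _ => rfl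
  have hinner : ∀ A w, inner ℝ (Ad A) w = -inner ℝ p (A w) := fun A w => by
    rw [hAd, inner_neg_left, ContinuousLinearMap.adjoint_inner_left]
  have hmax : ∀ t ∈ Icc P.t₀ ξ.T, ∀ v ∈ P.V, P.hamiltonian (P.state ξ t) v (Ad (M t)) t ≤
      P.hamiltonian (P.state ξ t) (ξ.u t) (Ad (M t)) t := by
    have hIco : ∀ t ∈ Ico P.t₀ ξ.T, ∀ v ∈ P.V,
        inner ℝ (Ad (M t)) (P.f (P.state ξ t) v t - P.f (P.state ξ t) (ξ.u t) t) ≤ 0 := by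
      intro t ht v hv
      rw [hinner, neg_nonpos]
      exact hl _ (Submodule.mem_sup_left (Submodule.subset_span ⟨t, ht, v, hv, rfl⟩))
    have hIcc : ∀ t ∈ Icc P.t₀ ξ.T, ∀ v ∈ P.V,
        inner ℝ (Ad (M t)) (P.f (P.state ξ t) v t - P.f (P.state ξ t) (ξ.u t) t) ≤ 0 := by
      intro t ht v hv
      rcases ht.2.lt_or_eq with h | rfl
      · exact hIco t ⟨ht.1, h⟩ v hv
      -- Needles start before `T`; the inequality at `T` is a limit from the left, by left
      -- continuity of the control there.
      have hc : ContinuousWithinAt (fun t => inner ℝ (Ad (M t))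
          (P.f (P.state ξ t) v t - P.f (P.state ξ t) (ξ.u t) t)) (Icc P.t₀ ξ.T) ξ.T := by
        refine ContinuousWithinAt.inner
          (Ad.continuous.continuousAt.comp_continuousWithinAt (hM _ hr)) ?_
        exact (((MayerProblem.isControl_const hv hT.le).pwc_f hP hT.le hst).sub hT.le
          (hcu.pwc_f hP hT.le hst)).2.2.2
      refine le_of_tendsto (hc.mono_left (nhdsLT_le_nhdsWithin_Icc ⟨hT, le_rfl⟩)) ?_
      filter_upwards [Ico_mem_nhdsLT hT] with t ht
      exact hIco t ht v hv
    intro t ht v hv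
    have := hIcc t ht v hv
    rw [inner_sub_right] at this
    exact sub_nonpos.1 this
  refine ⟨fun t => Ad (M t), fun k => l (Sum.inl k) - l (Sum.inr (Sum.inl k)),
    fun j => if P.ΦI j xT = 0 then l (Sum.inr (Sum.inr j)) else 0,
    ⟨Ad.continuous.comp_continuousOn hM, fun t ht => ?_⟩, hmax, ?_, fun j => ?_, fun j => ?_, ?_, ?_⟩
  -- From `M' = -M A` follows `ψ' = (M A)ᵀ p = Aᵀ Mᵀ p = -Aᵀ ψ`.
  · refine (Ad.hasFDerivAt.comp_hasDerivWithinAt t (hM' t ht)).congr_deriv ?_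
    rw [map_neg]
    change -Ad _ = -(ContinuousLinearMap.adjoint _) (Ad (M t))
    congr 1
    rw [hAd, hAd, map_neg]
    congr 1
    refine ext_inner_right ℝ fun w => ?_
    rw [ContinuousLinearMap.adjoint_inner_left, ContinuousLinearMap.adjoint_inner_left,
      ContinuousLinearMap.adjoint_inner_left]
    rfl
  · intro t ht hint hdiff
    have hd : HasFDerivAt (fun v => P.hamiltonian (P.state ξ t) v (Ad (M t)) t)
        ((innerSL ℝ (Ad (M t))).comp (P.fu (P.state ξ t) (ξ.u t) t)) (ξ.u t) :=
      (innerSL ℝ (Ad (M t))).hasFDerivAt.comp (ξ.u t) hdiff.hasFDerivAt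
    have hloc : IsLocalMax (fun v => P.hamiltonian (P.state ξ t) v (Ad (M t)) t) (ξ.u t) := by
      filter_upwards [mem_interior_iff_mem_nhds.1 hint] with v hv
      exact hmax t ht v hv
    have h0 := hloc.hasFDerivAt_eq_zero hd
    refine ext_inner_right ℝ fun w => ?_
    rw [ContinuousLinearMap.adjoint_inner_left, inner_zero_left]
    exact DFunLike.congr_fun h0 w
  · dsimp only
    split_ifs
    · exact hl0 _
    · exact le_rfl
  · dsimp only
    split_ifs with h
    · rw [h, mul_zero]
    · rw [zero_mul]
  · have h1 : Ad (M ξ.T) = -p := by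
      rw [hMT, hAd]
      congr 1
      refine ext_inner_right ℝ fun w => ?_
      rw [ContinuousLinearMap.adjoint_inner_left]
      rfl
    have h2 : ∀ j, (if P.ΦI j xT = 0 then l (Sum.inr (Sum.inr j)) else 0) • gradient (P.ΦI j) xT =
        l (Sum.inr (Sum.inr j)) • a (Sum.inr (Sum.inr j)) := fun j => by
      simp only [a, Sum.elim_inr]
      split_ifs <;> simp
    simp only [h2]
    rw [h1, hp, Fintype.sum_sum_type, Fintype.sum_sum_type]
    simp only [a, Sum.elim_inl, Sum.elim_inr, sub_smul, smul_neg, Finset.sum_neg_distrib,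
      Finset.sum_sub_distrib]
    abel
  · have h1 := hl fT (Submodule.mem_sup_right (Submodule.subset_span (by simp)))
    have h2 := hl (-fT) (Submodule.mem_sup_right (Submodule.subset_span (by simp)))
    rw [inner_neg_right] at h2
    have h3 : P.hamiltonian xT (ξ.u ξ.T) (Ad (M ξ.T)) ξ.T = -inner ℝ p fT := by
      rw [MayerProblem.hamiltonian, hinner, hMT]
      rfl
    rw [h3]
    linarith
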